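/- A BL-algebra is a structure $(L,\otimes,\to,0,1)$ in which $(L,\otimes,1)$ is a commutative monoid, $x\to x=1$, $x\otimes(x\to y)=y\otimes(y\to x)$, $x\to(y\to z)=(x\otimes y)\to z$, $0\to x=1$ and $(x\to y)\to z\le((y\to x)\to z)\to z$, where $x\le y$ means $x\to y=1$; it is a lattice under $\le$. Put $\bar x=x\to 0$ and $x+y=(\bar x\to y)\wedge(\bar y\to x)$; this is a commutative monoid operation with identity $0$. A good sequence in $L$ is a sequence $\mathbf a=(a_1,a_2,\dots)$ of elements of $L$ with $a_i+a_{i+1}=a_i$ for all $i$ and $a_i=0$ for all but finitely many $i$. The set $M_L$ of good sequences is ordered termwise (a lattice, with termwise operations), and $\mathbf a+\mathbf b\in M_L$ is the sequence with $n$-th term $a_n+(a_{n-1}\otimes b_1)+\dots+(a_1\otimes b_{n-1})+b_n$. The Chang $\ell$-group $G_L$ of $L$ is the quotient of $M_L\times M_L$ by the equivalence relation identifying $(\mathbf a,\mathbf b)$ and $(\mathbf c,\mathbf d)$ when $(\mathbf a+\mathbf d)+\mathbf k=(\mathbf b+\mathbf c)+\mathbf k$ for some $\mathbf k\in M_L$.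 Writing $[\mathbf a,\mathbf b]$ for the class of $(\mathbf a,\mathbf b)$, it is an abelian $\ell$-group with $[\mathbf a,\mathbf b]+[\mathbf c,\mathbf d]=[\mathbf a+\mathbf c,\mathbf b+\mathbf d]$, with $[\mathbf a,\mathbf b]\preceq[\mathbf c,\mathbf d]$ iff $(\mathbf a+\mathbf d)+\mathbf k\le(\mathbf b+\mathbf c)+\mathbf k$ for some $\mathbf k\in M_L$, and with $[\mathbf a,\mathbf b]\vee[\mathbf c,\mathbf d]=[(\mathbf a+\mathbf d)\vee(\mathbf b+\mathbf c),\mathbf b+\mathbf d]$ and dually for $\wedge$. **Theorem.** Let $L$ be a BL-algebra and let $A=\{\bar x:x\in L\}$ be its MV-center, a BL-algebra under the operations of $L$. The map $G_A\to G_L$, $[\mathbf a,\mathbf b]\mapsto[\mathbf a,\mathbf b]$, is an injective group homomorphism that preserves $\vee$ and $\wedge$ and preserves and reflects the order. Identifying $G_A$ with its image, $G_A$ is a direct summand of the abelian group $G_L$: the set $$\mathfrak S(L)=\{[\mathbf a,\mathbf b]:\mathbf a,\mathbf b\in M_L,\ \overline{\overline{a_i}}=\overline{\overline{b_i}}\text{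 for all }i\}$$ is a subgroup of $G_L$ with $G_L=G_A\oplus\mathfrak S(L)$ (that is, $G_A+\mathfrak S(L)=G_L$ and $G_A\cap\mathfrak S(L)=\{0\}$). Moreover $\mathfrak S(L)$ is an ideal of $G_L$: it is closed under $\vee$ and $\wedge$, and it is convex ($x\preceq y\preceq z$ with $x,z\in\mathfrak S(L)$ implies $y\in\mathfrak S(L)$). -/

import Mathlib

universe u v

/-- A BL-algebra: a bounded hoop `(L, *, ⇨, 0, 1)` satisfying the inequality
`(x ⇨ y) ⇨ z ≤ ((y ⇨ x) ⇨ z) ⇨ z`, where `a ≤ b` stands for `a ⇨ b = 1`. -/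
class BLAlgebra (L : Type u) extends CommMonoid L, HImp L, Zero L where
  himp_refl : ∀ x : L, x ⇨ x = 1
  mul_himp_comm : ∀ x y : L, x * (x ⇨ y) = y * (y ⇨ x)
  himp_curry : ∀ x y z : L, x ⇨ (y ⇨ z) = (x * y) ⇨ z
  zero_himp : ∀ x : L, 0 ⇨ x = 1
  prelinear : ∀ x y z : L, ((x ⇨ y) ⇨ z) ⇨ (((y ⇨ x) ⇨ z) ⇨ z) = 1

namespace BLAlgebra

section Basic

variable {L : Type u} [BLAlgebra L]

theorem antisymm_aux {x y : L} (h : x ⇨ y = 1) (h' : y ⇨ x = 1) : x = y := by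
  have := mul_himp_comm x y
  rwa [h, h', mul_one, mul_one] at this

theorem one_himp (x : L) : 1 ⇨ x = x := by
  apply antisymm_aux
  · have := himp_refl (1 ⇨ x)
    rwa [himp_curry, mul_one] at this
  · rw [himp_curry, mul_one, himp_refl]

theorem himp_one (x : L) : x ⇨ 1 = 1 := by
  have h := himp_refl (x ⇨ 1)
  rw [himp_curry, mul_comm, mul_himp_comm, one_mul, one_himp] at h
  exact h

theorem himp_trans_aux {x y z : L} (h : x ⇨ y = 1) (h' : y ⇨ z = 1) : x ⇨ z = 1 := by
  have e := mul_himp_comm x y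
  rw [h, mul_one] at e
  rw [e, mul_comm, ← himp_curry, h', himp_one]

/-- The natural order: `x ≤ y` iff `x ⇨ y = 1`. -/
instance instPartialOrder : PartialOrder L where
  le x y := x ⇨ y = 1
  le_refl := himp_refl
  le_trans _ _ _ := himp_trans_aux
  le_antisymm _ _ := antisymm_aux

theorem le_def {x y : L} : x ≤ y ↔ x ⇨ y = 1 := Iff.rfl

theorem le_one' (x : L) : x ≤ 1 := himp_one x

theorem zero_le' (x : L) : 0 ≤ x := zero_himp x

theorem eq_one_of_le {x : L} (h : 1 ≤ x) : x = 1 := le_antisymm (le_one' x) h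

theorem eq_zero_of_le {x : L} (h : x ≤ 0) : x = 0 := le_antisymm h (zero_le' x)

theorem mul_le_iff {x y z : L} : x * y ≤ z ↔ x ≤ y ⇨ z := by
  rw [le_def, le_def, himp_curry]

theorem mul_le_iff' {x y z : L} : x * y ≤ z ↔ y ≤ x ⇨ z := by
  rw [mul_comm, mul_le_iff]

theorem mul_himp_le (x y : L) : x * (x ⇨ y) ≤ y := mul_le_iff'.2 le_rfl

theorem mul_mono {x y z w : L} (h : x ≤ y) (h' : z ≤ w) : x * z ≤ y * w := by
  have h1 : x * z ≤ y * z := mul_le_iff.2 (h.trans (mul_le_iff.1 le_rfl))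
  exact h1.trans (mul_le_iff'.2 (h'.trans (mul_le_iff'.1 le_rfl)))

theorem mul_le_left (x y : L) : x * y ≤ x := by
  simpa using mul_mono (le_refl x) (le_one' y)

theorem mul_le_right (x y : L) : x * y ≤ y := by
  simpa using mul_mono (le_one' x) (le_refl y)

theorem himp_mono {x y z w : L} (h : y ≤ x) (h' : z ≤ w) : x ⇨ z ≤ y ⇨ w := by
  rw [← mul_le_iff']
  exact ((mul_mono h le_rfl).trans (mul_himp_le x z)).trans h'

theorem mul_himp_of_le {x y : L} (h : y ≤ x) : x * (x ⇨ y) = y := by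
  rw [mul_himp_comm, le_def.1 h, mul_one]

theorem le_himp_himp (x y : L) : x ≤ (x ⇨ y) ⇨ y := mul_le_iff.1 (mul_himp_le x y)

theorem le_himp (x y : L) : x ≤ y ⇨ x := mul_le_iff.1 (mul_le_left x y)

theorem prelinear_elim {x y z : L} (h : x ⇨ y ≤ z) (h' : y ⇨ x ≤ z) : z = 1 := by
  have := prelinear x y z
  rwa [le_def.1 h, le_def.1 h', one_himp, one_himp] at this

theorem le_inf_aux {x y z : L} (h : z ≤ x) (h' : z ≤ y) : z ≤ x * (x ⇨ y) := by
  have e : x * (x ⇨ z) = z := mul_himp_of_le h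
  rw [← e]
  exact mul_mono le_rfl (himp_mono le_rfl h')

/-- The lattice operations of a BL-algebra, in terms of `*` and `⇨`. -/
instance instLattice : Lattice L where
  inf x y := x * (x ⇨ y)
  inf_le_left x y := mul_le_left _ _
  inf_le_right x y := mul_himp_le _ _
  le_inf _ _ _ h h' := le_inf_aux h h'
  sup x y := ((x ⇨ y) ⇨ y) * (((x ⇨ y) ⇨ y) ⇨ ((y ⇨ x) ⇨ x))
  le_sup_left x y := le_inf_aux (le_himp_himp x y) (le_himp _ _)
  le_sup_right x y := le_inf_aux (le_himp _ _) (le_himp_himp _ _)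
  sup_le x y z h h' := by
    rw [le_def]
    apply prelinear_elim (x := x) (y := y)
    · rw [← mul_le_iff]
      exact ((mul_mono le_rfl (mul_le_left _ _)).trans (mul_himp_le _ _)).trans h'
    · rw [← mul_le_iff]
      exact ((mul_mono le_rfl (mul_himp_le _ _)).trans (mul_himp_le _ _)).trans h

theorem inf_def (x y : L) : x ⊓ y = x * (x ⇨ y) := rfl

theorem sup_def (x y : L) : x ⊔ y = ((x ⇨ y) ⇨ y) ⊓ ((y ⇨ x) ⇨ x) := rfl

/-- The complementation `xᶜ = x ⇨ 0`. -/
instance instCompl : Compl L := ⟨fun x => x ⇨ 0⟩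

theorem compl_def (x : L) : xᶜ = x ⇨ 0 := rfl

/-- The addition `x + y = (xᶜ ⇨ y) ⊓ (yᶜ ⇨ x)` of a BL-algebra. -/
instance instAdd : Add L := ⟨fun x y => (xᶜ ⇨ y) ⊓ (yᶜ ⇨ x)⟩

theorem add_def (x y : L) : x + y = (xᶜ ⇨ y) ⊓ (yᶜ ⇨ x) := rfl

theorem zero_mul' (x : L) : 0 * x = 0 := eq_zero_of_le (mul_le_left _ _)

theorem mul_zero' (x : L) : x * 0 = 0 := eq_zero_of_le (mul_le_right _ _)

theorem compl_zero : (0 : L)ᶜ = 1 := himp_refl 0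

theorem compl_one : (1 : L)ᶜ = 0 := one_himp 0

theorem mul_eq_zero_iff {x y : L} : x * y = 0 ↔ x ≤ yᶜ := by
  rw [compl_def, ← mul_le_iff]
  exact ⟨fun h => h.le, eq_zero_of_le⟩

theorem mul_compl (x : L) : x * xᶜ = 0 := eq_zero_of_le (mul_himp_le x 0)

theorem compl_anti {x y : L} (h : x ≤ y) : yᶜ ≤ xᶜ := himp_mono h le_rfl

theorem le_compl_compl (x : L) : x ≤ xᶜᶜ := le_himp_himp x 0

theorem compl3 (x : L) : xᶜᶜᶜ = xᶜ :=
  le_antisymm (compl_anti (le_compl_compl x)) (le_compl_compl xᶜ)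

theorem himp_compl (x y : L) : x ⇨ yᶜ = (x * y)ᶜ := himp_curry x y 0

theorem himp_compl_comm (x y : L) : x ⇨ yᶜ = y ⇨ xᶜ := by
  rw [himp_compl, himp_compl, mul_comm]

theorem compl_himp_self (x : L) : (xᶜᶜ ⇨ x)ᶜ = 0 := by
  have h1 : (xᶜᶜ ⇨ x)ᶜ ≤ xᶜᶜ := by
    have h0 : xᶜᶜᶜ ≤ xᶜᶜ ⇨ x := himp_mono le_rfl (zero_le' x)
    rw [compl3] at h0
    exact compl_anti h0
  have h2 := mul_himp_of_le h1
  rw [himp_compl, mul_himp_of_le (le_compl_compl x)] at h2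
  rw [← h2, mul_comm, mul_compl]

theorem add_comm' (x y : L) : x + y = y + x := by
  rw [add_def, add_def, inf_comm]

theorem add_zero' (x : L) : x + 0 = x := by
  rw [add_def, compl_zero, one_himp]
  exact inf_eq_right.2 (le_compl_compl x)

theorem add_one' (x : L) : x + 1 = 1 := by
  rw [add_def, himp_one, compl_one, zero_himp, inf_idem]

theorem add_mono {x y z w : L} (h : x ≤ y) (h' : z ≤ w) : x + z ≤ y + w :=
  inf_le_inf (himp_mono (compl_anti h) h') (himp_mono (compl_anti h') h)

theorem le_add_left' (x y : L) : x ≤ x + y := by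
  have := add_mono (le_refl x) (zero_le' y)
  rwa [add_zero'] at this

theorem le_add_right' (x y : L) : x ≤ y + x := by
  rw [add_comm']
  exact le_add_left' x y

end Basic

end BLAlgebra

/-- Homomorphisms of BL-algebras. -/
structure BLHom (L : Type u) (M : Type v) [BLAlgebra L] [BLAlgebra M] where
  toFun : L → M
  map_mul' : ∀ x y, toFun (x * y) = toFun x * toFun y
  map_himp' : ∀ x y, toFun (x ⇨ y) = toFun x ⇨ toFun y
  map_zero' : toFun 0 = 0

namespace BLHom

variable {L : Type u} {M : Type v} [BLAlgebra L] [BLAlgebra M]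

instance : CoeFun (BLHom L M) (fun _ => L → M) := ⟨BLHom.toFun⟩

variable (f : BLHom L M)

theorem map_mul (x y : L) : f (x * y) = f x * f y := f.map_mul' x y

theorem map_himp (x y : L) : f (x ⇨ y) = f x ⇨ f y := f.map_himp' x y

theorem map_zero : f 0 = 0 := f.map_zero'

theorem map_one : f 1 = 1 := by
  rw [← BLAlgebra.himp_refl (0 : L), map_himp, BLAlgebra.himp_refl]

theorem map_compl (x : L) : f xᶜ = (f x)ᶜ := by
  rw [BLAlgebra.compl_def, map_himp, map_zero, BLAlgebra.compl_def]

theorem map_inf (x y : L) : f (x ⊓ y) = f x ⊓ f y := by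
  rw [BLAlgebra.inf_def, map_mul, map_himp, BLAlgebra.inf_def]

theorem map_sup (x y : L) : f (x ⊔ y) = f x ⊔ f y := by
  simp only [BLAlgebra.sup_def, map_inf, map_himp]

theorem map_add (x y : L) : f (x + y) = f x + f y := by
  simp only [BLAlgebra.add_def, map_inf, map_himp, map_compl]

theorem mono {x y : L} (h : x ≤ y) : f x ≤ f y := by
  rw [BLAlgebra.le_def] at h ⊢
  rw [← map_himp, h, map_one]

end BLHom

/-- A BL-chain, assumed to have at least two elements. -/
class IsBLChain (C : Type u) [BLAlgebra C] : Prop where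
  total : ∀ x y : C, x ≤ y ∨ y ≤ x
  zero_ne_one : (0 : C) ≠ 1

namespace BLAlgebra

section Transfer

variable {L : Type u} [BLAlgebra L]

/-- Deductive systems (filters) of a BL-algebra. -/
structure IsDed (F : Set L) : Prop where
  one_mem : 1 ∈ F
  mp : ∀ {x y : L}, x ∈ F → x ⇨ y ∈ F → y ∈ F

theorem IsDed.up {F : Set L} (hF : IsDed F) {x y : L} (hx : x ∈ F) (h : x ≤ y) : y ∈ F := by
  apply hF.mp hx
  rw [le_def.1 h]
  exact hF.one_mem

theorem IsDed.mul {F : Set L} (hF : IsDed F) {x y : L} (hx : x ∈ F) (hy : y ∈ F) :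
    x * y ∈ F :=
  hF.mp hy (hF.up hx (mul_le_iff.1 le_rfl))

theorem isDed_gen {F : Set L} (hF : IsDed F) (u : L) :
    IsDed {z | ∃ f ∈ F, ∃ n : ℕ, f * u ^ n ≤ z} := by
  constructor
  · exact ⟨1, hF.one_mem, 0, le_one' _⟩
  · rintro z w ⟨f, hf, n, h⟩ ⟨g, hg, m, h'⟩
    refine ⟨f * g, hF.mul hf hg, n + m, ?_⟩
    rw [pow_add, mul_mul_mul_comm]
    exact (mul_mono h h').trans (mul_himp_le z w)

theorem prelinear_pow (x y : L) (n m : ℕ) (h d : L) (h1 : h * (x ⇨ y) ^ n ≤ d)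
    (h2 : h * (y ⇨ x) ^ m ≤ d) : h ≤ d := by
  have base : ∀ h : L, h * (x ⇨ y) ≤ d → h * (y ⇨ x) ≤ d → h ≤ d := by
    intro h h1 h2
    exact prelinear_elim (mul_le_iff'.1 h1) (mul_le_iff'.1 h2)
  have aux : ∀ (m : ℕ) (h : L), h * (x ⇨ y) ≤ d → h * (y ⇨ x) ^ m ≤ d → h ≤ d := by
    intro m
    induction m with
    | zero => intro h _ h2; simpa using h2
    | succ m ih =>
      intro h h1 h2
      apply base h h1
      apply ih
      · exact (mul_mono (mul_le_left _ _) le_rfl).trans h1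
      · rwa [mul_assoc, ← pow_succ']
  induction n generalizing h with
  | zero => simpa using h1
  | succ n ih =>
    apply aux m h _ h2
    apply ih
    · rwa [mul_assoc, ← pow_succ']
    · exact (mul_mono (mul_le_left _ _) le_rfl).trans h2

theorem exists_prime (d : L) (hd : d ≠ 1) :
    ∃ F : Set L, IsDed F ∧ d ∉ F ∧ ∀ x y : L, x ⇨ y ∈ F ∨ y ⇨ x ∈ F := by
  obtain ⟨F, -, hF⟩ := zorn_subset_nonempty {F : Set L | IsDed F ∧ d ∉ F} (by
    intro c hc hchain hne
    refine ⟨⋃₀ c, ⟨⟨?_, ?_⟩, ?_⟩, fun s hs => Set.subset_sUnion_of_mem hs⟩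
    · obtain ⟨s, hs⟩ := hne
      exact ⟨s, hs, (hc hs).1.one_mem⟩
    · rintro x y ⟨s, hs, hx⟩ ⟨t, ht, hy⟩
      rcases hchain.total hs ht with h | h
      · exact ⟨t, ht, (hc ht).1.mp (h hx) hy⟩
      · exact ⟨s, hs, (hc hs).1.mp hx (h hy)⟩
    · rintro ⟨s, hs, h⟩
      exact (hc hs).2 h) {1} ⟨⟨rfl, by
        intro x y hx hy
        rw [Set.mem_singleton_iff] at hx hy ⊢
        rwa [hx, one_himp] at hy⟩, hd⟩
  obtain ⟨hded, hdF⟩ := hF.prop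
  refine ⟨F, hded, hdF, ?_⟩
  have key : ∀ u : L, u ∉ F → ∃ f ∈ F, ∃ n : ℕ, f * u ^ n ≤ d := by
    intro u hu
    by_contra hcon
    have hle := hF.le_of_ge (y := {z | ∃ f ∈ F, ∃ n : ℕ, f * u ^ n ≤ z})
      ⟨isDed_gen hded u, hcon⟩
      (fun f hf => ⟨f, hf, 0, by simp⟩)
    exact hu (hle ⟨1, hded.one_mem, 1, by simp⟩)
  intro x y
  by_contra! hcon
  obtain ⟨f, hf, n, h1⟩ := key _ hcon.1
  obtain ⟨g, hg, m, h2⟩ := key _ hcon.2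
  apply hdF
  apply hded.up (hded.mul hf hg)
  exact prelinear_pow x y n m _ _ ((mul_mono (mul_le_left _ _) le_rfl).trans h1)
    ((mul_mono (mul_le_right _ _) le_rfl).trans h2)

/-- The congruence of a deductive system. -/
def dedSetoid (F : Set L) (hF : IsDed F) : Setoid L where
  r x y := x ⇨ y ∈ F ∧ y ⇨ x ∈ F
  iseqv := by
    have tr : ∀ x y z : L, x ⇨ y ∈ F → y ⇨ z ∈ F → x ⇨ z ∈ F := by
      intro x y z h h'
      apply hF.up (hF.mul h h')
      rw [← mul_le_iff', ← mul_assoc]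
      exact (mul_mono (mul_himp_le x y) le_rfl).trans (mul_himp_le y z)
    refine ⟨fun x => ?_, fun h => ⟨h.2, h.1⟩, fun h h' => ⟨tr _ _ _ h.1 h'.1, tr _ _ _ h'.2 h.2⟩⟩
    rw [himp_refl]
    exact ⟨hF.one_mem, hF.one_mem⟩

theorem ded_mul {F : Set L} (hF : IsDed F) {x x' y y' : L} (h : x ⇨ x' ∈ F) (h' : y ⇨ y' ∈ F) :
    (x * y) ⇨ (x' * y') ∈ F := by
  apply hF.up (hF.mul h h')
  rw [← mul_le_iff', mul_mul_mul_comm]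
  exact mul_mono (mul_himp_le _ _) (mul_himp_le _ _)

theorem ded_himp {F : Set L} (hF : IsDed F) {x x' y y' : L} (h : x' ⇨ x ∈ F) (h' : y ⇨ y' ∈ F) :
    (x ⇨ y) ⇨ (x' ⇨ y') ∈ F := by
  apply hF.up (hF.mul h h')
  rw [← mul_le_iff', ← mul_le_iff']
  calc x' * ((x ⇨ y) * ((x' ⇨ x) * (y ⇨ y')))
      = ((x' * (x' ⇨ x)) * (x ⇨ y)) * (y ⇨ y') := by ac_rfl
    _ ≤ (x * (x ⇨ y)) * (y ⇨ y') := mul_mono (mul_mono (mul_himp_le _ _) le_rfl) le_rfl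
    _ ≤ y * (y ⇨ y') := mul_mono (mul_himp_le _ _) le_rfl
    _ ≤ y' := mul_himp_le _ _

/-- The quotient of a BL-algebra by a deductive system. -/
def DedQuot (F : Set L) (hF : IsDed F) : Type u := Quotient (dedSetoid F hF)

/-- The BL-algebra structure of the quotient. -/
instance instDedQuot (F : Set L) (hF : IsDed F) : BLAlgebra (DedQuot F hF) :=
  letI := dedSetoid F hF
  { mul := Quotient.map₂ (· * ·) fun _ _ h _ _ h' =>
      ⟨ded_mul hF h.1 h'.1, ded_mul hF h.2 h'.2⟩
    himp := Quotient.map₂ (· ⇨ ·) fun _ _ h _ _ h' =>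
      ⟨ded_himp hF h.2 h'.1, ded_himp hF h.1 h'.2⟩
    one := ⟦1⟧
    zero := ⟦0⟧
    mul_assoc := by
      rintro ⟨x⟩ ⟨y⟩ ⟨z⟩
      exact congrArg (Quotient.mk _) (mul_assoc x y z)
    one_mul := by
      rintro ⟨x⟩
      exact congrArg (Quotient.mk _) (one_mul x)
    mul_one := by
      rintro ⟨x⟩
      exact congrArg (Quotient.mk _) (mul_one x)
    mul_comm := by
      rintro ⟨x⟩ ⟨y⟩
      exact congrArg (Quotient.mk _) (mul_comm x y)
    himp_refl := by
      rintro ⟨x⟩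
      exact congrArg (Quotient.mk _) (himp_refl x)
    mul_himp_comm := by
      rintro ⟨x⟩ ⟨y⟩
      exact congrArg (Quotient.mk _) (mul_himp_comm x y)
    himp_curry := by
      rintro ⟨x⟩ ⟨y⟩ ⟨z⟩
      exact congrArg (Quotient.mk _) (himp_curry x y z)
    zero_himp := by
      rintro ⟨x⟩
      exact congrArg (Quotient.mk _) (zero_himp x)
    prelinear := by
      rintro ⟨x⟩ ⟨y⟩ ⟨z⟩
      exact congrArg (Quotient.mk _) (prelinear x y z) }

/-- An inequality that holds under every homomorphism to a BL-chain holds. -/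
theorem le_of_chain {s t : L}
    (h : ∀ (C : Type u) [BLAlgebra C] [IsBLChain C] (f : BLHom L C), f s ≤ f t) : s ≤ t := by
  by_contra hst
  obtain ⟨F, hF, hd, hp⟩ := exists_prime (s ⇨ t) hst
  let q : L → DedQuot F hF := fun x => Quotient.mk (dedSetoid F hF) x
  have le_iff : ∀ x y : L, (q x ≤ q y) ↔
      x ⇨ y ∈ F := by
    intro x y
    have : (q x ≤ q y) ↔
      Quotient.mk (dedSetoid F hF) (x ⇨ y) = Quotient.mk (dedSetoid F hF) 1 := Iff.rfl
    rw [this, Quotient.eq]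
    constructor
    · intro h
      have := h.2
      rwa [one_himp] at this
    · intro h
      refine ⟨?_, ?_⟩
      · rw [himp_one]
        exact hF.one_mem
      · rwa [one_himp]
  have : IsBLChain (DedQuot F hF) := by
    constructor
    · rintro ⟨x⟩ ⟨y⟩
      rcases hp x y with h | h
      · exact Or.inl ((le_iff x y).2 h)
      · exact Or.inr ((le_iff y x).2 h)
    · intro h
      apply hd
      have h2 : s ⇨ t ∈ F ↔ _ := (le_iff s t).symm
      rw [h2]
      have all : ∀ z : DedQuot F hF, z = 0 := fun z =>
        eq_zero_of_le ((le_one' z).trans h.symm.le)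
      rw [all (q t), all (q s)]
  have := h (DedQuot F hF)
    { toFun := q
      map_mul' := fun _ _ => rfl
      map_himp' := fun _ _ => rfl
      map_zero' := rfl }
  exact hd ((le_iff s t).1 this)

theorem eq_of_chain {s t : L}
    (h : ∀ (C : Type u) [BLAlgebra C] [IsBLChain C] (f : BLHom L C), f s = f t) : s = t :=
  le_antisymm (le_of_chain fun C _ _ f => (h C f).le) (le_of_chain fun C _ _ f => (h C f).ge)

end Transfer

end BLAlgebra

namespace BLAlgebra

section Chain

set_option linter.unusedSectionVars false

variable {C : Type u} [BLAlgebra C] [IsBLChain C]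

theorem chain_cases (x : C) : xᶜ = 0 ∨ xᶜᶜ = x := by
  have h1 : xᶜᶜ * (xᶜᶜ ⇨ x) = x := mul_himp_of_le (le_compl_compl x)
  have h2 := compl_himp_self x
  rcases IsBLChain.total (xᶜᶜ ⇨ x) xᶜᶜ with h | h
  · left
    have := compl_anti h
    rw [h2, compl3] at this
    exact eq_zero_of_le this
  · right
    have h3 : (xᶜᶜ ⇨ x) ⇨ xᶜᶜ = xᶜᶜ := by
      rw [himp_compl_comm, compl_def (xᶜᶜ ⇨ x), ← compl_def, h2]
      rfl
    have h4 := mul_himp_of_le h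
    rw [h3, mul_comm, h1] at h4
    exact h4.symm

theorem compl_eq_one {x : C} (h : xᶜ = 1) : x = 0 := by
  have := le_compl_compl x
  rw [h, compl_one] at this
  exact eq_zero_of_le this

theorem dense_ne_zero {x : C} (h : xᶜ = 0) : x ≠ 0 := by
  rintro rfl
  rw [compl_zero] at h
  exact IsBLChain.zero_ne_one h.symm

theorem dense_add {x y : C} (h : xᶜ = 0) (hy : y ≠ 0) : x + y = 1 := by
  rw [add_def, h, zero_himp]
  have : yᶜ ≤ x := by
    rcases IsBLChain.total yᶜ x with h' | h'
    · exact h'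
    · exfalso
      have h2 := compl_anti h'
      rw [h] at h2
      exact hy (eq_zero_of_le ((le_compl_compl y).trans h2))
  rw [le_def.1 this, inf_idem]

theorem add_dense {x y : C} (h : yᶜ = 0) (hx : x ≠ 0) : x + y = 1 := by
  rw [add_comm', dense_add h hx]

theorem dense_mul {x y : C} (h : xᶜ = 0) (h' : yᶜ = 0) : (x * y)ᶜ = 0 := by
  rw [← himp_compl, h', ← compl_def, h]

theorem dense_mul_reg {x y : C} (h : xᶜ = 0) (hy : yᶜᶜ = y) (hy1 : y ≠ 1) : x * y = y := by
  have hle : y ≤ x := by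
    rcases IsBLChain.total y x with h' | h'
    · exact h'
    · exfalso
      have := compl_anti h'
      rw [h] at this
      apply hy1
      rw [← hy, eq_zero_of_le this, compl_zero]
  have h2 := mul_himp_of_le hle
  have h3 : x ⇨ y = y := by
    conv_lhs => rw [← hy]
    rw [himp_compl_comm, h]
    exact hy
  rwa [h3] at h2

theorem reg_mul {x y : C} (hx : xᶜᶜ = x) (hy : yᶜᶜ = y) : (x * y)ᶜᶜ = x * y := by
  rcases chain_cases (x * y) with h | h
  · rw [← himp_compl] at h
    have : yᶜ ≤ 0 := by
      rw [← h]
      exact le_himp _ _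
    have hy1 : y = 1 := by
      rw [← hy, eq_zero_of_le this, compl_zero]
    rw [hy1, mul_one, hx]
  · exact h

theorem reg_himp {x y : C} (hy : yᶜᶜ = y) : (x ⇨ y)ᶜᶜ = x ⇨ y := by
  rw [← hy, himp_compl, compl3]

theorem contra {x y : C} (hx : xᶜᶜ = x) (hy : yᶜᶜ = y) : xᶜ ⇨ y = yᶜ ⇨ x := by
  conv_lhs => rw [← hy]
  rw [himp_compl_comm, hx]

theorem add_reg {x y : C} (hx : xᶜᶜ = x) (hy : yᶜᶜ = y) : x + y = xᶜ ⇨ y := by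
  rw [add_def, ← contra hx hy, inf_idem]

theorem add_reg' {x y : C} (hx : xᶜᶜ = x) (hy : yᶜᶜ = y) : x + y = (xᶜ * yᶜ)ᶜ := by
  rw [add_reg hx hy, ← himp_compl, hy]

theorem reg_add {x y : C} (hx : xᶜᶜ = x) (hy : yᶜᶜ = y) : (x + y)ᶜᶜ = x + y := by
  rw [add_reg hx hy, reg_himp hy]

theorem mul_eq_zero_of_add {x y : C} (h : x + y ≠ 1) : x * y = 0 := by
  rw [mul_eq_zero_iff]
  rcases IsBLChain.total x yᶜ with h1 | h1
  · exact h1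
  rcases IsBLChain.total y xᶜ with h2 | h2
  · rwa [← mul_eq_zero_iff, mul_comm, mul_eq_zero_iff]
  · exact absurd (by rw [add_def, le_def.1 h1, le_def.1 h2, inf_idem]) h

theorem one_add_chain (x : C) : 1 + x = 1 := by
  rw [add_comm', add_one']

theorem zero_add_chain (x : C) : 0 + x = x := by
  rw [add_comm', add_zero']

theorem add_ne_zero_right {x y : C} (h : y ≠ 0) : x + y ≠ 0 := fun h' =>
  h (eq_zero_of_le (h' ▸ le_add_right' y x))

theorem add_ne_zero_left {x y : C} (h : x ≠ 0) : x + y ≠ 0 := fun h' =>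
  h (eq_zero_of_le (h' ▸ le_add_left' x y))

theorem add_assoc_chain (x y z : C) : x + y + z = x + (y + z) := by
  by_cases hx0 : x = 0
  · subst hx0
    rw [zero_add_chain, zero_add_chain]
  by_cases hy0 : y = 0
  · subst hy0
    rw [add_zero', zero_add_chain]
  by_cases hz0 : z = 0
  · subst hz0
    rw [add_zero', add_zero']
  rcases chain_cases x with hx | hx
  · rw [dense_add hx hy0, one_add_chain, dense_add hx (add_ne_zero_left hy0)]
  rcases chain_cases y with hy | hy
  · rw [add_dense hy hx0, dense_add hy hz0, one_add_chain, add_one']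
  rcases chain_cases z with hz | hz
  · rw [add_dense hz hy0, add_dense hz (add_ne_zero_left hx0), add_one']
  have e1 := reg_mul (show xᶜᶜᶜ = xᶜ from compl3 x) (show yᶜᶜᶜ = yᶜ from compl3 y)
  have e2 := reg_mul (show yᶜᶜᶜ = yᶜ from compl3 y) (show zᶜᶜᶜ = zᶜ from compl3 z)
  rw [add_reg' (reg_add hx hy) hz, add_reg' hx (reg_add hy hz), add_reg' hx hy, add_reg' hy hz,
    e1, e2, mul_assoc]

theorem add_mul_absorb_chain (x y : C) : x + y + x * y = x + y := by
  by_cases h : x + y = 1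
  · rw [h, one_add_chain]
  · rw [mul_eq_zero_of_add h, add_zero']

theorem add_eq_self {x y : C} (h : x + y = x) : x = 1 ∨ y = 0 := by
  by_contra! hcon
  obtain ⟨hx1, hy0⟩ := hcon
  have hxy : x * y = 0 := mul_eq_zero_of_add (by rwa [h])
  have hx0 : x ≠ 0 := by
    rintro rfl
    rw [zero_add_chain] at h
    exact hy0 h
  rcases chain_cases x with hx | hx
  · rw [dense_add hx hy0] at h
    exact hx1 h.symm
  rcases chain_cases y with hy | hy
  · rw [add_dense hy hx0] at h
    exact hx1 h.symm
  rw [add_reg hx hy] at h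
  have hle : y ≤ xᶜ := by rwa [← mul_eq_zero_iff, mul_comm]
  have := mul_himp_of_le hle
  rw [h, mul_comm, mul_compl] at this
  exact hy0 this.symm

/-- In a chain, `(z ⇨ w) ⇨ w = z` for regular `w ≤ z`. -/
theorem himp_himp_reg {z w : C} (hz : zᶜᶜ = z) (hw : wᶜᶜ = w) (h : w ≤ z) :
    (z ⇨ w) ⇨ w = z := by
  have e : z ⇨ w = wᶜ ⇨ zᶜ := by
    conv_lhs => rw [← hw]
    rw [himp_compl_comm]
  have h2 : wᶜ * (wᶜ ⇨ zᶜ) = zᶜ := mul_himp_of_le (compl_anti h)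
  calc (z ⇨ w) ⇨ w = (z ⇨ w) ⇨ wᶜᶜ := by rw [hw]
    _ = (wᶜ * (wᶜ ⇨ zᶜ))ᶜ := by rw [himp_compl, e, mul_comm]
    _ = z := by rw [h2, hz]

theorem exchange_reg {x y z : C} (hx : xᶜᶜ = x) (hy : yᶜᶜ = y) (hz : zᶜᶜ = z) :
    x * y + (x + y) * z = x * z + (x + z) * y := by
  have key : ∀ a b c : C, aᶜᶜ = a → bᶜᶜ = b → cᶜᶜ = c → a * b = 0 → a + c = 1 →
      (a + b) * c = a * c + b := by
    intro a b c ha hb hc h1 h2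
    have hba : b ≤ aᶜ := by rwa [← mul_eq_zero_iff, mul_comm]
    have hac : aᶜ ≤ c := by
      rw [add_reg ha hc] at h2
      exact h2
    have hw : aᶜᶜᶜ = aᶜ := compl3 a
    rw [add_reg ha hb, add_reg (reg_mul ha hc) hb, ← himp_compl, himp_compl_comm]
    have e1 : aᶜ ⇨ b = c ⇨ ((c ⇨ aᶜ) ⇨ b) := by
      rw [himp_curry, mul_himp_of_le hac]
    rw [e1, mul_comm]
    apply mul_himp_of_le
    calc (c ⇨ aᶜ) ⇨ b ≤ (c ⇨ aᶜ) ⇨ aᶜ := himp_mono le_rfl hba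
      _ = c := himp_himp_reg hc hw hac
  by_cases h1 : x + y = 1
  · by_cases h2 : x + z = 1
    · rw [h1, h2, one_mul, one_mul]
      have hxy : xᶜ ≤ y := by
        rw [add_reg hx hy] at h1
        exact h1
      have hxz : xᶜ ≤ z := by
        rw [add_reg hx hz] at h2
        exact h2
      have hw : xᶜᶜᶜ = xᶜ := compl3 x
      have e : ∀ a b : C, aᶜᶜ = a → bᶜᶜ = b → xᶜ ≤ b →
          x * a + b = (a ⇨ xᶜ) ⇨ ((b ⇨ xᶜ) ⇨ xᶜ) := by
        intro a b ha hb hxb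
        rw [himp_himp_reg hb hw hxb, add_reg (reg_mul hx ha) hb, ← himp_compl, himp_compl_comm]
      rw [e y z hy hz hxz, e z y hz hy hxy, himp_curry, himp_curry, mul_comm]
    · rw [h1, one_mul, mul_eq_zero_of_add h2, zero_add_chain,
        key x z y hx hz hy (mul_eq_zero_of_add h2) h1]
  · by_cases h2 : x + z = 1
    · rw [h2, one_mul, mul_eq_zero_of_add h1, zero_add_chain,
        key x y z hx hy hz (mul_eq_zero_of_add h1) h2]
    · have a1 := mul_eq_zero_of_add h1
      have a2 := mul_eq_zero_of_add h2
      rw [a1, a2, zero_add_chain, zero_add_chain, add_reg hx hy, add_reg hx hz]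
      have hyx : y ≤ xᶜ := by rwa [← mul_eq_zero_iff, mul_comm]
      have hzx : z ≤ xᶜ := by rwa [← mul_eq_zero_iff, mul_comm]
      calc (xᶜ ⇨ y) * z = (xᶜ ⇨ y) * (xᶜ * (xᶜ ⇨ z)) := by rw [mul_himp_of_le hzx]
        _ = (xᶜ ⇨ z) * (xᶜ * (xᶜ ⇨ y)) := by ac_rfl
        _ = (xᶜ ⇨ z) * y := by rw [mul_himp_of_le hyx]

theorem compl_compl_add_chain (x y : C) : (x + y)ᶜᶜ = xᶜᶜ + yᶜᶜ := by
  by_cases hx0 : x = 0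
  · rw [hx0, compl_zero, compl_one, zero_add_chain, zero_add_chain]
  by_cases hy0 : y = 0
  · rw [hy0, compl_zero, compl_one, add_zero', add_zero']
  rcases chain_cases x with hx | hx
  · rw [dense_add hx hy0, hx, compl_zero, one_add_chain, compl_one, compl_zero]
  rcases chain_cases y with hy | hy
  · rw [add_dense hy hx0, hy, compl_zero, add_one', compl_one, compl_zero]
  rw [reg_add hx hy, hx, hy]

theorem compl_compl_mul_chain (x y : C) : (x * y)ᶜᶜ = xᶜᶜ * yᶜᶜ := by
  have main : ∀ x y : C, xᶜ = 0 → (x * y)ᶜᶜ = xᶜᶜ * yᶜᶜ := by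
    intro x y hx
    rw [← himp_compl, himp_compl_comm, hx, compl_zero, one_mul]
    rfl
  rcases chain_cases x with hx | hx
  · exact main x y hx
  rcases chain_cases y with hy | hy
  · rw [mul_comm, main y x hy, mul_comm]
  rw [reg_mul hx hy, hx, hy]

end Chain

section Monoid

variable {L : Type u} [BLAlgebra L]

/-- The addition of a BL-algebra makes it a commutative monoid. -/
instance instAddCommMonoid : AddCommMonoid L where
  add_assoc x y z := eq_of_chain fun C _ _ f => by
    simp only [BLHom.map_add, add_assoc_chain]
  zero_add x := by rw [add_comm', add_zero']
  add_zero := add_zero'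
  add_comm := add_comm'
  nsmul := nsmulRec

theorem compl_compl_add (x y : L) : (x + y)ᶜᶜ = xᶜᶜ + yᶜᶜ :=
  eq_of_chain fun C _ _ f => by
    simp only [BLHom.map_add, BLHom.map_compl, compl_compl_add_chain]

theorem compl_compl_mul (x y : L) : (x * y)ᶜᶜ = xᶜᶜ * yᶜᶜ :=
  eq_of_chain fun C _ _ f => by
    simp only [BLHom.map_mul, BLHom.map_compl, compl_compl_mul_chain]

end Monoid

end BLAlgebra

namespace BLAlgebra

section More

variable {L : Type u} [BLAlgebra L]

instance instIsOrderedAddMonoid : IsOrderedAddMonoid L where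
  add_le_add_left _ _ h _ := add_mono h le_rfl

theorem compl_compl_himp (x y : L) : (x ⇨ y)ᶜᶜ = xᶜᶜ ⇨ yᶜᶜ := by
  have e : xᶜᶜ ⇨ yᶜᶜ = x ⇨ yᶜᶜ := by
    rw [himp_compl_comm, compl3, himp_compl_comm]
  rw [e]
  refine eq_of_chain fun C _ _ f => ?_
  simp only [BLHom.map_himp, BLHom.map_compl]
  rcases chain_cases (f y) with h | h
  · have h2 : (f x ⇨ f y)ᶜ = 0 := by
      apply eq_zero_of_le
      rw [← h]
      exact compl_anti (le_himp _ _)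
    rw [h, h2, compl_zero, himp_one]
  · rw [h, reg_himp h]

end More

end BLAlgebra

/-- Double negation, as an endomorphism. -/
def BLHom.dneg (L : Type u) [BLAlgebra L] : BLHom L L where
  toFun x := xᶜᶜ
  map_mul' := BLAlgebra.compl_compl_mul
  map_himp' := BLAlgebra.compl_compl_himp
  map_zero' := by rw [BLAlgebra.compl_zero, BLAlgebra.compl_one]

/-- A homomorphism of BL-algebras preserves finite sums. -/
theorem BLHom.map_sum {L : Type u} {M : Type v} [BLAlgebra L] [BLAlgebra M] (f : BLHom L M)
    {ι : Type*} (s : Finset ι) (g : ι → L) : f (∑ i ∈ s, g i) = ∑ i ∈ s, f (g i) :=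
  _root_.map_sum (⟨⟨f, f.map_zero⟩, f.map_add⟩ : L →+ M) g s

namespace BLAlgebra

section Seq

variable {L : Type u} [BLAlgebra L]

/-- The sequence `(1, a 0, a 1, …)`. -/
def consOne (a : ℕ → L) : ℕ → L
  | 0 => 1
  | i + 1 => a i

@[simp] theorem consOne_zero (a : ℕ → L) : consOne a 0 = 1 := rfl

@[simp] theorem consOne_succ (a : ℕ → L) (i : ℕ) : consOne a (i + 1) = a i := rfl

/-- The sum of two sequences. Terms are indexed from `0`, so that `a i` is the term `a_{i+1}` of
`(a_1, a_2, …)`; with the convention `a_0 = b_0 = 1`, the `n`-th term of the sum,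
`a_n + a_{n-1} * b_1 + ⋯ + a_1 * b_{n-1} + b_n`, is the sum of all `a_j * b_k` with
`j + k = n`. -/
def seqAdd (a b : ℕ → L) (i : ℕ) : L :=
  ∑ p ∈ Finset.HasAntidiagonal.antidiagonal (i + 1), consOne a p.1 * consOne b p.2

/-- Being a good sequence: `a_i + a_{i+1} = a_i` for all `i`, and all but finitely many terms
vanish. -/
structure IsGood (a : ℕ → L) : Prop where
  add_succ : ∀ i, a i + a (i + 1) = a i
  finite : ∃ n, ∀ r, n ≤ r → a r = 0

/-- The sequence `(a)`, that is, `(a, 0, 0, …)`. -/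
def singleSeq (a : L) : ℕ → L
  | 0 => a
  | _ + 1 => 0

@[simp] theorem singleSeq_zero (a : L) : singleSeq a 0 = a := rfl

@[simp] theorem singleSeq_succ (a : L) (i : ℕ) : singleSeq a (i + 1) = 0 := rfl

theorem isGood_single (a : L) : IsGood (singleSeq a) := by
  refine ⟨?_, 1, ?_⟩
  · rintro (_ | i)
    · simp
    · simp
  · rintro (_ | i) h
    · omega
    · rfl

theorem isGood_consOne {a : ℕ → L} (h : IsGood a) : IsGood (consOne a) := by
  obtain ⟨h1, n, h2⟩ := h
  refine ⟨?_, n + 1, ?_⟩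
  · rintro (_ | i)
    · rw [consOne_zero, add_comm, add_one']
    · exact h1 i
  · rintro (_ | i) h
    · omega
    · exact h2 i (by omega)

theorem seqAdd_comm (a b : ℕ → L) : seqAdd a b = seqAdd b a := by
  funext i
  unfold seqAdd
  rw [← Finset.Nat.sum_antidiagonal_swap]
  simp only [Prod.fst_swap, Prod.snd_swap, mul_comm]

theorem consOne_seqAdd {a b : ℕ → L} (hb : IsGood b) :
    seqAdd (consOne a) b = consOne (seqAdd a b) := by
  funext i
  rcases i with _ | i
  · simp only [seqAdd, Finset.Nat.sum_antidiagonal_succ, Finset.Nat.antidiagonal_zero]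
    simp [add_one']
  · simp only [seqAdd, consOne_succ]
    rw [Finset.Nat.sum_antidiagonal_succ, Finset.Nat.sum_antidiagonal_succ]
    simp only [consOne_zero, consOne_succ, one_mul]
    rw [← add_assoc, add_comm (b (i + 1)), hb.add_succ]
    rw [Finset.Nat.sum_antidiagonal_succ (n := i)]
    simp only [consOne_zero, consOne_succ, one_mul]

theorem seqAdd_zero (a : ℕ → L) : seqAdd a (singleSeq 0) = a := by
  funext i
  rw [seqAdd_comm]
  have h0 : ∀ j, singleSeq (0 : L) j = 0 := by rintro (_ | j) <;> rfl
  simp only [seqAdd, Finset.Nat.sum_antidiagonal_succ, consOne_succ, h0, zero_mul']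
  simp

/-- The sum of `(x, y)` and `(c)`. -/
theorem seqAdd_pair {u : ℕ → L} (hu : ∀ i, 2 ≤ i → u i = 0) (c : L) :
    seqAdd u (singleSeq c) 0 = u 0 + c ∧ seqAdd u (singleSeq c) 1 = u 1 + u 0 * c ∧
      seqAdd u (singleSeq c) 2 = u 1 * c ∧ ∀ i, 3 ≤ i → seqAdd u (singleSeq c) i = 0 := by
  refine ⟨?_, ?_, ?_, ?_⟩
  · simp [seqAdd, Finset.Nat.sum_antidiagonal_succ, add_comm]
  · simp [seqAdd, Finset.Nat.sum_antidiagonal_succ, add_comm, consOne, singleSeq, mul_zero']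
  · simp [seqAdd, Finset.Nat.sum_antidiagonal_succ, consOne, singleSeq, mul_zero', hu]
  · intro i hi
    unfold seqAdd
    apply Finset.sum_eq_zero
    rintro ⟨j, k⟩ hjk
    rw [Finset.HasAntidiagonal.mem_antidiagonal] at hjk
    simp only at hjk ⊢
    by_cases hj : 3 ≤ j
    · obtain ⟨j, rfl⟩ := Nat.exists_eq_add_of_le' hj
      rw [show j + 3 = (j + 2) + 1 from rfl, consOne_succ, hu _ (by omega), zero_mul']
    · have hk : 2 ≤ k := by omega
      obtain ⟨k, rfl⟩ := Nat.exists_eq_add_of_le' hk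
      rw [show k + 2 = (k + 1) + 1 from rfl, consOne_succ, singleSeq_succ, mul_zero']

theorem map_consOne {M : Type v} [BLAlgebra M] (f : BLHom L M) (a : ℕ → L) (i : ℕ) :
    f (consOne a i) = consOne (fun j => f (a j)) i := by
  rcases i with _ | i
  · exact f.map_one
  · rfl

theorem map_seqAdd {M : Type v} [BLAlgebra M] (f : BLHom L M) (a b : ℕ → L) (i : ℕ) :
    f (seqAdd a b i) = seqAdd (fun j => f (a j)) (fun j => f (b j)) i := by
  simp only [seqAdd, BLHom.map_sum, BLHom.map_mul, map_consOne]

theorem isGood_map {M : Type v} [BLAlgebra M] (f : BLHom L M) {a : ℕ → L} (h : IsGood a) :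
    IsGood (fun i => f (a i)) := by
  obtain ⟨h1, n, h2⟩ := h
  refine ⟨fun i => ?_, n, fun r hr => ?_⟩
  · rw [← f.map_add, h1]
  · rw [h2 r hr, f.map_zero]

theorem isGood_tail {a : ℕ → L} (h : IsGood a) : IsGood (fun i => a (i + 1)) := by
  obtain ⟨h1, n, h2⟩ := h
  exact ⟨fun i => h1 (i + 1), n, fun r hr => h2 _ (by omega)⟩

theorem isGood_induction {C : Type u} [BLAlgebra C] [IsBLChain C] {P : ∀ a : ℕ → C, IsGood a → Prop}
    (h1 : ∀ a, P (singleSeq a) (isGood_single a))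
    (h2 : ∀ a (ha : IsGood a), P a ha → P (consOne a) (isGood_consOne ha))
    (a : ℕ → C) (ha : IsGood a) : P a ha := by
  obtain ⟨n, hn⟩ := ha.finite
  induction n generalizing a with
  | zero =>
    have : a = singleSeq 0 := by
      funext i
      rw [hn i (Nat.zero_le _)]
      rcases i with _ | i <;> rfl
    subst this
    exact h1 0
  | succ n ih =>
    by_cases h0 : a 0 = 1
    · have : a = consOne (fun i => a (i + 1)) := by
        funext i
        rcases i with _ | i
        · exact h0
        · rfl
      have h3 := h2 _ (isGood_tail ha) (ih _ (isGood_tail ha) fun r hr => hn _ (by omega))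
      simpa only [← this] using h3
    · have : a = singleSeq (a 0) := by
        funext i
        rcases i with _ | i
        · rfl
        · rw [singleSeq_succ]
          induction i with
          | zero => exact (add_eq_self (ha.add_succ 0)).resolve_left h0
          | succ i ih2 =>
            have := ha.add_succ (i + 1)
            rwa [ih2, zero_add] at this
      have h3 := h1 (a 0)
      simpa only [← this] using h3

theorem isGood_seqAdd_chain {C : Type u} [BLAlgebra C] [IsBLChain C] {a b : ℕ → C}
    (ha : IsGood a) (hb : IsGood b) : IsGood (seqAdd a b) := by
  induction a, ha using isGood_induction with
  | h1 x =>
    induction b, hb using isGood_induction with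
    | h1 y =>
      obtain ⟨e0, e1, e2, e3⟩ := seqAdd_pair (u := singleSeq x)
        (by
          intro i hi
          obtain ⟨i, rfl⟩ := Nat.exists_eq_add_of_le' hi
          rfl) y
      rw [singleSeq_zero] at e0 e1
      rw [show (1 : ℕ) = 0 + 1 from rfl, singleSeq_succ] at e1 e2
      rw [zero_mul'] at e2
      rw [zero_add, zero_add] at e1
      refine ⟨?_, 2, ?_⟩
      · rintro (_ | _ | _ | i)
        · rw [e0, zero_add, e1, add_mul_absorb_chain]
        · rw [zero_add, e1, e2, add_zero]
        · rw [e3 (0 + 1 + 1 + 1) (by omega), add_zero]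
        · rw [e3 (i + 1 + 1 + 1 + 1) (by omega), add_zero]
      · intro r hr
        rcases hr.eq_or_lt with h | h
        · rw [← h, e2]
        · exact e3 r h
    | h2 y hy ih =>
      rw [seqAdd_comm, consOne_seqAdd (isGood_single x), seqAdd_comm]
      exact isGood_consOne ih
  | h2 x hx ih =>
    rw [consOne_seqAdd hb]
    exact isGood_consOne ih

theorem isGood_of_chain {a : ℕ → L} (h0 : ∃ n, ∀ r, n ≤ r → a r = 0)
    (h : ∀ (C : Type u) [BLAlgebra C] [IsBLChain C] (f : BLHom L C), IsGood (fun i => f (a i))) :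
    IsGood a :=
  ⟨fun i => eq_of_chain fun C _ _ f => by rw [f.map_add]; exact (h C f).add_succ i, h0⟩

/-- The sum of good sequences is a good sequence. -/
theorem isGood_seqAdd {a b : ℕ → L} (ha : IsGood a) (hb : IsGood b) : IsGood (seqAdd a b) := by
  apply isGood_of_chain
  · obtain ⟨n, hn⟩ := ha.finite
    obtain ⟨m, hm⟩ := hb.finite
    refine ⟨n + m, fun r hr => ?_⟩
    unfold seqAdd
    apply Finset.sum_eq_zero
    rintro ⟨j, k⟩ hjk
    rw [Finset.HasAntidiagonal.mem_antidiagonal] at hjk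
    simp only at hjk ⊢
    by_cases hj : n + 1 ≤ j
    · obtain ⟨j, rfl⟩ := Nat.exists_eq_add_of_le' (show 1 ≤ j by omega)
      rw [consOne_succ, hn _ (by omega), zero_mul']
    · obtain ⟨k, rfl⟩ := Nat.exists_eq_add_of_le' (show 1 ≤ k by omega)
      rw [consOne_succ, hm _ (by omega), mul_zero']
  · intro C _ _ f
    have := isGood_seqAdd_chain (isGood_map f ha) (isGood_map f hb)
    rwa [← funext (map_seqAdd f a b)] at this

theorem isGood_sup_inf_chain {C : Type u} [BLAlgebra C] [IsBLChain C] {a b : ℕ → C}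
    (ha : IsGood a) (hb : IsGood b) : (∀ i, a i ≤ b i) ∨ (∀ i, b i ≤ a i) := by
  induction a, ha using isGood_induction generalizing b with
  | h1 x =>
    induction b, hb using isGood_induction with
    | h1 y =>
      rcases IsBLChain.total x y with h | h
      · left
        rintro (_ | i)
        · exact h
        · exact le_rfl
      · right
        rintro (_ | i)
        · exact h
        · exact le_rfl
    | h2 y hy ih =>
      left
      rintro (_ | i)
      · exact le_one' _
      · exact zero_le' _
  | h2 x hx ih =>
    induction b, hb using isGood_induction with
    | h1 y =>
      right
      rintro (_ | i)
      · exact le_one' _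
      · exact zero_le' _
    | h2 y hy ih2 =>
      rcases ih hy with h | h
      · left
        rintro (_ | i)
        · exact le_rfl
        · exact h i
      · right
        rintro (_ | i)
        · exact le_rfl
        · exact h i

theorem isGood_sup {a b : ℕ → L} (ha : IsGood a) (hb : IsGood b) :
    IsGood (fun i => a i ⊔ b i) := by
  apply isGood_of_chain
  · obtain ⟨n, hn⟩ := ha.finite
    obtain ⟨m, hm⟩ := hb.finite
    exact ⟨n + m, fun r hr => by rw [hn r (by omega), hm r (by omega), sup_idem]⟩
  · intro C _ _ f
    simp only [BLHom.map_sup]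
    rcases isGood_sup_inf_chain (isGood_map f ha) (isGood_map f hb) with h | h
    · simpa only [sup_eq_right.2 (h _)] using isGood_map f hb
    · simpa only [sup_eq_left.2 (h _)] using isGood_map f ha

theorem isGood_inf {a b : ℕ → L} (ha : IsGood a) (hb : IsGood b) :
    IsGood (fun i => a i ⊓ b i) := by
  apply isGood_of_chain
  · obtain ⟨n, hn⟩ := ha.finite
    obtain ⟨m, hm⟩ := hb.finite
    exact ⟨n + m, fun r hr => by rw [hn r (by omega), hm r (by omega), inf_idem]⟩
  · intro C _ _ f
    simp only [BLHom.map_inf]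
    rcases isGood_sup_inf_chain (isGood_map f ha) (isGood_map f hb) with h | h
    · simpa only [inf_eq_left.2 (h _)] using isGood_map f ha
    · simpa only [inf_eq_right.2 (h _)] using isGood_map f hb

end Seq

end BLAlgebra

/-- The set `M_L` of good sequences of a BL-algebra `L`. -/
@[ext] structure GoodSeq (L : Type u) [BLAlgebra L] where
  seq : ℕ → L
  isGood : BLAlgebra.IsGood seq

namespace GoodSeq

open BLAlgebra

section General

variable {L : Type u} [BLAlgebra L]

instance : CoeFun (GoodSeq L) (fun _ => ℕ → L) := ⟨GoodSeq.seq⟩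

theorem ext' {u v : GoodSeq L} (h : ∀ i, u i = v i) : u = v := GoodSeq.ext (funext h)

/-- The one-term sequence `(a)`. -/
def single (a : L) : GoodSeq L := ⟨singleSeq a, isGood_single a⟩

/-- `(1, a_1, a_2, …)`. -/
def shift (u : GoodSeq L) : GoodSeq L := ⟨consOne u, isGood_consOne u.isGood⟩

instance : Zero (GoodSeq L) := ⟨single 0⟩

/-- The addition of good sequences. -/
instance : Add (GoodSeq L) := ⟨fun u v => ⟨seqAdd u v, isGood_seqAdd u.isGood v.isGood⟩⟩

/-- The lattice of good sequences, with the termwise order and operations. -/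
instance : Lattice (GoodSeq L) where
  le u v := ∀ i, u i ≤ v i
  le_refl u i := le_rfl
  le_trans u v w h h' i := (h i).trans (h' i)
  le_antisymm u v h h' := ext' fun i => le_antisymm (h i) (h' i)
  sup u v := ⟨fun i => u i ⊔ v i, isGood_sup u.isGood v.isGood⟩
  inf u v := ⟨fun i => u i ⊓ v i, isGood_inf u.isGood v.isGood⟩
  le_sup_left _ _ _ := le_sup_left
  le_sup_right _ _ _ := le_sup_right
  sup_le _ _ _ h h' i := sup_le (h i) (h' i)
  inf_le_left _ _ _ := inf_le_left
  inf_le_right _ _ _ := inf_le_right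
  le_inf _ _ _ h h' i := le_inf (h i) (h' i)

theorem le_def {u v : GoodSeq L} : u ≤ v ↔ ∀ i, u i ≤ v i := Iff.rfl

/-- The image of a good sequence under a homomorphism. -/
def map {M : Type v} [BLAlgebra M] (f : BLHom L M) (u : GoodSeq L) : GoodSeq M :=
  ⟨fun i => f (u i), isGood_map f u.isGood⟩

section Map

variable {M : Type v} [BLAlgebra M] (f : BLHom L M)

theorem map_single (a : L) : map f (single a) = single (f a) := by
  apply ext'
  rintro (_ | i)
  · rfl
  · exact f.map_zero

theorem map_zero : map f 0 = 0 := (map_single f 0).trans (by rw [f.map_zero]; rfl)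

theorem map_add (u v : GoodSeq L) : map f (u + v) = map f u + map f v :=
  ext' fun i => map_seqAdd f u v i

theorem map_sup (u v : GoodSeq L) : map f (u ⊔ v) = map f u ⊔ map f v :=
  ext' fun i => f.map_sup (u i) (v i)

theorem map_inf (u v : GoodSeq L) : map f (u ⊓ v) = map f u ⊓ map f v :=
  ext' fun i => f.map_inf (u i) (v i)

theorem map_mono {u v : GoodSeq L} (h : u ≤ v) : map f u ≤ map f v := fun i => f.mono (h i)

end Map

theorem le_of_chain {u v : GoodSeq L}
    (h : ∀ (C : Type u) [BLAlgebra C] [IsBLChain C] (f : BLHom L C), map f u ≤ map f v) :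
    u ≤ v :=
  fun i => BLAlgebra.le_of_chain fun C _ _ f => h C f i

theorem eq_of_chain {u v : GoodSeq L}
    (h : ∀ (C : Type u) [BLAlgebra C] [IsBLChain C] (f : BLHom L C), map f u = map f v) :
    u = v :=
  le_antisymm (le_of_chain fun C _ _ f => (h C f).le) (le_of_chain fun C _ _ f => (h C f).ge)

protected theorem add_comm (u v : GoodSeq L) : u + v = v + u :=
  GoodSeq.ext (seqAdd_comm u v)

protected theorem add_zero (u : GoodSeq L) : u + 0 = u := GoodSeq.ext (seqAdd_zero u)

protected theorem zero_add (u : GoodSeq L) : 0 + u = u := by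
  rw [GoodSeq.add_comm, GoodSeq.add_zero]

theorem shift_add (u v : GoodSeq L) : shift u + v = shift (u + v) :=
  GoodSeq.ext (consOne_seqAdd v.isGood)

theorem add_shift (u v : GoodSeq L) : u + shift v = shift (u + v) := by
  rw [GoodSeq.add_comm, shift_add, GoodSeq.add_comm]

theorem add_le_add_right' {u v : GoodSeq L} (h : u ≤ v) (w : GoodSeq L) : u + w ≤ v + w := by
  intro i
  change seqAdd u w i ≤ seqAdd v w i
  apply Finset.sum_le_sum
  rintro ⟨j, k⟩ -
  apply mul_mono _ le_rfl
  rcases j with _ | j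
  · exact le_rfl
  · exact h j

theorem shift_le_shift {u v : GoodSeq L} : shift u ≤ shift v ↔ u ≤ v := by
  constructor
  · intro h i
    exact h (i + 1)
  · rintro h (_ | i)
    · exact le_rfl
    · exact h i

/-- `(1, …, 1, a_1, a_2, …)` with `n` additional ones. -/
def shifts (n : ℕ) (u : GoodSeq L) : GoodSeq L := shift^[n] u

theorem shifts_succ (n : ℕ) (u : GoodSeq L) : shifts (n + 1) u = shift (shifts n u) :=
  Function.iterate_succ_apply' _ _ _

theorem add_shifts (n : ℕ) (u : GoodSeq L) : u + shifts n 0 = shifts n u := by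
  induction n with
  | zero => exact GoodSeq.add_zero u
  | succ n ih => rw [shifts_succ, shifts_succ, add_shift, ih]

theorem shifts_le_shifts (n : ℕ) {u v : GoodSeq L} : shifts n u ≤ shifts n v ↔ u ≤ v := by
  induction n with
  | zero => exact Iff.rfl
  | succ n ih => rw [shifts_succ, shifts_succ, shift_le_shift, ih]

theorem single_add_of_eq_one {a b : L} (h : a + b = 1) :
    single a + single b = shift (single (a * b)) := by
  obtain ⟨e0, e1, e2, e3⟩ := seqAdd_pair (u := singleSeq a)
    (by
      intro i hi
      obtain ⟨i, rfl⟩ := Nat.exists_eq_add_of_le' hi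
      rfl) b
  apply ext'
  rintro (_ | _ | _ | i)
  · exact e0.trans h
  · exact e1.trans (zero_add _)
  · exact e2.trans (zero_mul' _)
  · exact e3 _ (by omega)

theorem single_assoc {a b c : L} (h : b * a + (b + a) * c = b * c + (b + c) * a) :
    single a + single b + single c = single a + (single b + single c) := by
  have pr : ∀ x y : L, (single x + single y) 0 = x + y ∧ (single x + single y) 1 = x * y ∧
      ∀ i, 2 ≤ i → (single x + single y) i = 0 := by
    intro x y
    obtain ⟨e0, e1, e2, e3⟩ := seqAdd_pair (u := singleSeq x)
      (by
        intro i hi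
        obtain ⟨i, rfl⟩ := Nat.exists_eq_add_of_le' hi
        rfl) y
    refine ⟨e0, e1.trans (zero_add _), fun i hi => ?_⟩
    rcases hi.eq_or_lt with h | h
    · rw [← h]
      exact e2.trans (zero_mul' _)
    · exact e3 i h
  obtain ⟨a0, a1, a2⟩ := pr a b
  obtain ⟨b0, b1, b2⟩ := pr b c
  obtain ⟨e0, e1, e2, e3⟩ := seqAdd_pair (u := (single a + single b).seq) a2 c
  obtain ⟨f0, f1, f2, f3⟩ := seqAdd_pair (u := (single b + single c).seq) b2 a
  rw [GoodSeq.add_comm (single a) (single b + single c)]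
  apply ext'
  rintro (_ | _ | _ | i)
  · refine e0.trans (Eq.trans ?_ f0.symm)
    rw [a0, b0]
    ac_rfl
  · refine e1.trans (Eq.trans ?_ f1.symm)
    rw [a0, a1, b0, b1, mul_comm a b, add_comm a b, h]
  · refine e2.trans (Eq.trans ?_ f2.symm)
    rw [a1, b1]
    ac_rfl
  · exact (e3 _ (by omega)).trans (f3 _ (by omega)).symm

end General

section Chain

set_option linter.unusedSectionVars false

variable {C : Type u} [BLAlgebra C] [IsBLChain C]

theorem chain_induction {P : GoodSeq C → Prop} (h1 : ∀ a, P (single a))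
    (h2 : ∀ u, P u → P (shift u)) (u : GoodSeq C) : P u :=
  isGood_induction (P := fun a ha => P ⟨a, ha⟩) h1 (fun a ha => h2 ⟨a, ha⟩) u.seq u.isGood

protected theorem total (u v : GoodSeq C) : u ≤ v ∨ v ≤ u :=
  isGood_sup_inf_chain u.isGood v.isGood

theorem assoc_of_mem (S : Set C)
    (hS : ∀ a ∈ S, ∀ b ∈ S, ∀ c ∈ S, b * a + (b + a) * c = b * c + (b + c) * a)
    (u v w : GoodSeq C) (hu : ∀ i, u i ∈ S) (hv : ∀ i, v i ∈ S) (hw : ∀ i, w i ∈ S) :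
    u + v + w = u + (v + w) := by
  induction u using chain_induction with
  | h2 u ih => rw [shift_add, shift_add, shift_add, ih fun i => hu (i + 1)]
  | h1 a =>
    induction v using chain_induction with
    | h2 v ih => rw [add_shift, shift_add, shift_add, add_shift, ih fun i => hv (i + 1)]
    | h1 b =>
      induction w using chain_induction with
      | h2 w ih => rw [add_shift, add_shift, add_shift, ih fun i => hw (i + 1)]
      | h1 c => exact single_assoc (hS a (hu 0) b (hv 0) c (hw 0))

/-- All terms are regular. -/
def IsReg (u : GoodSeq C) : Prop := ∀ i, (u i)ᶜᶜ = u i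

theorem assoc_reg {u v w : GoodSeq C} (hu : IsReg u) (hv : IsReg v) (hw : IsReg w) :
    u + v + w = u + (v + w) :=
  assoc_of_mem {x | xᶜᶜ = x} (fun _ ha _ hb _ hc => exchange_reg hb ha hc) u v w hu hv hw

/-- All terms are zero or dense. -/
def IsDense (u : GoodSeq C) : Prop := ∀ i, u i = 0 ∨ (u i)ᶜ = 0

theorem assoc_dense {u v w : GoodSeq C} (hu : IsDense u) (hv : IsDense v) (hw : IsDense w) :
    u + v + w = u + (v + w) := by
  apply assoc_of_mem {x | x = 0 ∨ xᶜ = 0} _ u v w hu hv hw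
  rintro a (rfl | ha) b (rfl | hb) c (rfl | hc)
  all_goals try simp only [zero_mul', mul_zero', zero_add, add_zero]
  · exact mul_comm _ _
  · rw [dense_add hb (dense_ne_zero ha), dense_add hb (dense_ne_zero hc), one_mul, one_mul,
      dense_add (dense_mul hb ha) (dense_ne_zero hc),
      dense_add (dense_mul hb hc) (dense_ne_zero ha)]

theorem dense_single {a : C} (h : aᶜ = 0) : IsDense (single a) := by
  rintro (_ | i)
  · exact Or.inr h
  · exact Or.inl rfl

theorem dense_add' {u v : GoodSeq C} (hu : IsDense u) (hv : IsDense v) : IsDense (u + v) := by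
  have hs : ∀ w : GoodSeq C, IsDense w → IsDense (shift w) := by
    rintro w hw (_ | i)
    · exact Or.inr compl_one
    · exact hw i
  induction u using chain_induction with
  | h2 u ih =>
    rw [shift_add]
    exact hs _ (ih fun i => hu (i + 1))
  | h1 a =>
    induction v using chain_induction with
    | h2 v ih =>
      rw [add_shift]
      exact hs _ (ih fun i => hv (i + 1))
    | h1 b =>
      rcases hu 0 with ha | ha
      · have : single a = 0 := congrArg single ha
        rwa [this, GoodSeq.zero_add]
      rcases hv 0 with hb | hb
      · have : single b = 0 := congrArg single hb
        rwa [this, GoodSeq.add_zero]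
      rw [single_add_of_eq_one (a := a) (b := b) (dense_add ha (dense_ne_zero hb))]
      exact hs _ (dense_single (dense_mul ha hb))

/-- The termwise double negation of a good sequence. -/
def dneg {L : Type u} [BLAlgebra L] (u : GoodSeq L) : GoodSeq L := map (BLHom.dneg L) u

theorem reg_dneg (u : GoodSeq C) : IsReg (dneg u) := fun i => compl3 (u i)ᶜ

theorem dneg_add {L : Type u} [BLAlgebra L] (u v : GoodSeq L) :
    dneg (u + v) = dneg u + dneg v := map_add _ u v

theorem dneg_of_reg {u : GoodSeq C} (h : IsReg u) : dneg u = u := ext' h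

theorem exists_complement {k : GoodSeq C} (hk : IsReg k) :
    ∃ l : GoodSeq C, ∃ n, IsReg l ∧ k + l = shifts n 0 := by
  induction k using chain_induction with
  | h2 k ih =>
    obtain ⟨l, n, hl, e⟩ := ih fun i => hk (i + 1)
    exact ⟨l, n + 1, hl, by rw [shift_add, e, shifts_succ]⟩
  | h1 t =>
    have ht : tᶜᶜ = t := hk 0
    refine ⟨single tᶜ, 1, ?_, ?_⟩
    · rintro (_ | i)
      · exact compl3 t
      · exact (BLHom.dneg C).map_zero
    · have : t + tᶜ = 1 := by
        rw [add_reg ht (compl3 t), himp_refl]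
      rw [single_add_of_eq_one this, mul_compl]
      rfl

theorem reg_add' {u v : GoodSeq C} (hu : IsReg u) (hv : IsReg v) : IsReg (u + v) := by
  rw [← dneg_of_reg hu, ← dneg_of_reg hv, ← dneg_add]
  exact reg_dneg _

theorem cancel_reg {u v k : GoodSeq C} (hu : IsReg u) (hv : IsReg v) (hk : IsReg k)
    (h : u + k ≤ v + k) : u ≤ v := by
  obtain ⟨l, n, hl, e⟩ := exists_complement hk
  have := add_le_add_right' h l
  rwa [assoc_reg hu hk hl, assoc_reg hv hk hl, e, add_shifts, add_shifts,
    shifts_le_shifts] at this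

theorem add_absorb {g : C} (h0 : g ≠ 0) (h1 : gᶜ ≠ 0) (u : GoodSeq C) :
    u + single g = dneg u + single g := by
  have hs : ∀ u : GoodSeq C, dneg (shift u) = shift (dneg u) := by
    intro u
    apply ext'
    rintro (_ | i)
    · exact (BLHom.dneg C).map_one
    · rfl
  induction u using chain_induction with
  | h2 u ih => rw [hs, shift_add, shift_add, ih]
  | h1 a =>
    have e : dneg (single a) = single aᶜᶜ := map_single _ a
    rw [e]
    rcases chain_cases a with h | h
    · have hg : gᶜᶜ = g := (chain_cases g).resolve_left h1
      have hg1 : g ≠ 1 := by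
        rintro rfl
        exact h1 compl_one
      rw [h, compl_zero, single_add_of_eq_one (dense_add h h0), dense_mul_reg h hg hg1,
        single_add_of_eq_one (one_add_chain g), one_mul]
    · rw [h]

theorem cancel_dense {u v k : GoodSeq C} (hu : IsDense u) (hv : IsDense v) (hk : IsDense k)
    {g : C} (hg : ∀ i, (k i)ᶜ = 0 → ∃ σ : C, σᶜ = 0 ∧ k i * σ = g) (h : u + k ≤ v + k) :
    u + single g ≤ v + single g := by
  induction k using chain_induction with
  | h2 k ih =>
    rw [add_shift, add_shift, shift_le_shift] at h
    exact ih (fun i => hk (i + 1)) (fun i => hg (i + 1)) h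
  | h1 t =>
    rcases hk 0 with ht | ht
    · have : single t = 0 := congrArg single ht
      rw [this, GoodSeq.add_zero, GoodSeq.add_zero] at h
      exact add_le_add_right' h _
    · obtain ⟨σ, hσ, e⟩ := hg 0 ht
      have h2 := add_le_add_right' h (single σ)
      have e' : t * σ = g := e
      have ht' : tᶜ = 0 := ht
      rwa [assoc_dense hu hk (dense_single hσ), assoc_dense hv hk (dense_single hσ),
        single_add_of_eq_one (dense_add ht' (dense_ne_zero hσ)), e', add_shift, add_shift,
        shift_le_shift] at h2

end Chain

end GoodSeq

namespace GoodSeq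

open BLAlgebra

section Absorb

/-- The join of all `x ⊓ xᶜ`. -/
def fracPart {L : Type u} [BLAlgebra L] : List L → L
  | [] => 0
  | x :: X => (x ⊓ xᶜ) ⊔ fracPart X

/-- The product of all `x ⊔ xᶜ`. -/
def densePart {L : Type u} [BLAlgebra L] : List L → L
  | [] => 1
  | x :: X => (x ⊔ xᶜ) * densePart X

/-- An element that absorbs the differences produced by the elements of a list. -/
def absorb {L : Type u} [BLAlgebra L] (X : List L) : L :=
  (densePart X ⊓ (fracPart X)ᶜ) ⊔ fracPart X

theorem map_fracPart {L : Type u} [BLAlgebra L] {M : Type v} [BLAlgebra M] (f : BLHom L M)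
    (X : List L) : f (fracPart X) = fracPart (X.map f) := by
  induction X with
  | nil => exact f.map_zero
  | cons x X ih => simp only [fracPart, List.map_cons, f.map_sup, f.map_inf, f.map_compl, ih]

theorem map_densePart {L : Type u} [BLAlgebra L] {M : Type v} [BLAlgebra M] (f : BLHom L M)
    (X : List L) : f (densePart X) = densePart (X.map f) := by
  induction X with
  | nil => exact f.map_one
  | cons x X ih => simp only [densePart, List.map_cons, f.map_sup, f.map_mul, f.map_compl, ih]

theorem map_absorb {L : Type u} [BLAlgebra L] {M : Type v} [BLAlgebra M] (f : BLHom L M)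
    (X : List L) : f (absorb X) = absorb (X.map f) := by
  simp only [absorb, f.map_sup, f.map_inf, f.map_compl, map_fracPart, map_densePart]

variable {C : Type u} [BLAlgebra C] [IsBLChain C]

theorem fracPart_spec (X : List C) : (fracPart X)ᶜᶜ = fracPart X ∧
    fracPart X ≤ (fracPart X)ᶜ ∧ (fracPart X = 0 → ∀ x ∈ X, x = 0 ∨ xᶜ = 0) := by
  induction X with
  | nil =>
    refine ⟨?_, ?_, ?_⟩
    · exact (BLHom.dneg C).map_zero
    · exact zero_le' _
    · simp
  | cons x X ih =>
    obtain ⟨h1, h2, h3⟩ := ih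
    have hm : ∃ m : C, x ⊓ xᶜ = m ∧ mᶜᶜ = m ∧ m ≤ mᶜ ∧ (m = 0 → x = 0 ∨ xᶜ = 0) := by
      rcases chain_cases x with h | h
      · refine ⟨0, ?_, (BLHom.dneg C).map_zero, zero_le' _, fun _ => Or.inr h⟩
        rw [h]
        exact inf_eq_right.2 (zero_le' x)
      · rcases IsBLChain.total x xᶜ with h' | h'
        · exact ⟨x, inf_eq_left.2 h', h, h', Or.inl⟩
        · exact ⟨xᶜ, inf_eq_right.2 h', compl3 x, by rwa [h], Or.inr⟩
    obtain ⟨m, e, hm1, hm2, hm3⟩ := hm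
    have h4 : fracPart (x :: X) = 0 → ∀ y ∈ x :: X, y = 0 ∨ yᶜ = 0 := by
      intro h y hy
      have hle : x ⊓ xᶜ ⊔ fracPart X ≤ 0 := h.le
      rcases List.mem_cons.1 hy with rfl | hy
      · exact hm3 (eq_zero_of_le (by rw [← e]; exact le_sup_left.trans hle))
      · exact h3 (eq_zero_of_le (le_sup_right.trans hle)) y hy
    rcases IsBLChain.total m (fracPart X) with h | h
    · have : fracPart (x :: X) = fracPart X := by
        simp only [fracPart, e, sup_eq_right.2 h]
      exact ⟨by rw [this, h1], by rw [this]; exact h2, h4⟩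
    · have : fracPart (x :: X) = m := by
        simp only [fracPart, e, sup_eq_left.2 h]
      exact ⟨by rw [this, hm1], by rw [this]; exact hm2, h4⟩

theorem densePart_spec (X : List C) (hX : ∀ x ∈ X, x = 0 ∨ xᶜ = 0) :
    (densePart X)ᶜ = 0 ∧ ∀ x ∈ X, xᶜ = 0 → ∃ σ : C, σᶜ = 0 ∧ x * σ = densePart X := by
  induction X with
  | nil => exact ⟨compl_one, by simp⟩
  | cons x X ih =>
    obtain ⟨h1, h2⟩ := ih fun y hy => hX y (List.mem_cons_of_mem _ hy)
    have hd : (x ⊔ xᶜ)ᶜ = 0 ∧ (xᶜ = 0 → x ⊔ xᶜ = x) := by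
      refine ⟨?_, fun h => by rw [h]; exact sup_eq_left.2 (zero_le' x)⟩
      rcases hX x List.mem_cons_self with h | h
      · rw [h, compl_zero, sup_eq_right.2 (zero_le' 1), compl_one]
      · rw [h, sup_eq_left.2 (zero_le' x), h]
    refine ⟨dense_mul hd.1 h1, fun y hy hy0 => ?_⟩
    rcases List.mem_cons.1 hy with rfl | hy
    · exact ⟨densePart X, h1, by simp only [densePart, hd.2 hy0]⟩
    · obtain ⟨σ, hσ, e⟩ := h2 y hy hy0
      refine ⟨(x ⊔ xᶜ) * σ, dense_mul hd.1 hσ, ?_⟩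
      simp only [densePart]
      rw [← e]
      ac_rfl

theorem absorb_spec (X : List C) : (absorb X ≠ 0 ∧ (absorb X)ᶜ ≠ 0) ∨
    ((∀ x ∈ X, x = 0 ∨ xᶜ = 0) ∧
      ∀ x ∈ X, xᶜ = 0 → ∃ σ : C, σᶜ = 0 ∧ x * σ = absorb X) := by
  obtain ⟨h1, h2, h3⟩ := fracPart_spec X
  by_cases he : fracPart X = 0
  · right
    refine ⟨h3 he, ?_⟩
    have : absorb X = densePart X := by
      rw [absorb, he, compl_zero, inf_eq_left.2 (le_one' _), sup_eq_left.2 (zero_le' _)]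
    rw [this]
    exact (densePart_spec X (h3 he)).2
  · left
    constructor
    · intro h
      exact he (eq_zero_of_le (by rw [← h]; exact le_sup_right))
    · intro h
      have hle : absorb X ≤ (fracPart X)ᶜ := sup_le inf_le_right h2
      have := compl_anti hle
      rw [h, h1] at this
      exact he (eq_zero_of_le this)

/-- All nonzero terms of `u` belong to the list `X`. -/
def Covers {L : Type u} [BLAlgebra L] (X : List L) (u : GoodSeq L) : Prop :=
  ∀ i, u i = 0 ∨ u i ∈ X

theorem Covers.map {L : Type u} [BLAlgebra L] {M : Type v} [BLAlgebra M] (f : BLHom L M)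
    {X : List L} {u : GoodSeq L} (h : Covers X u) : Covers (X.map f) (map f u) := by
  intro i
  rcases h i with h | h
  · left
    exact (congrArg f h).trans f.map_zero
  · exact Or.inr (List.mem_map_of_mem h)

theorem exists_covers {L : Type u} [BLAlgebra L] (us : List (GoodSeq L)) :
    ∃ X : List L, ∀ u ∈ us, Covers X u := by
  induction us with
  | nil => exact ⟨[], by simp⟩
  | cons u us ih =>
    obtain ⟨X, hX⟩ := ih
    obtain ⟨n, hn⟩ := u.isGood.finite
    refine ⟨(List.range n).map u ++ X, fun v hv i => ?_⟩
    rw [List.mem_append]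
    rcases List.mem_cons.1 hv with rfl | hv
    · by_cases h : i < n
      · exact Or.inr (Or.inl (List.mem_map_of_mem (List.mem_range.2 h)))
      · exact Or.inl (hn i (by omega))
    · exact (hX v hv i).imp_right Or.inr

theorem absorb_chain {X : List C} {u v w k : GoodSeq C} (hu : Covers X u) (hv : Covers X v)
    (hw : Covers X w) (hk : Covers X k) :
    u + v + w + single (absorb X) = u + (v + w) + single (absorb X) ∧
    (u + k ≤ v + k → u + w + single (absorb X) ≤ v + w + single (absorb X)) ∧
    (Covers X (w + k) → u + w + k ≤ v + w + k →
      u + single (absorb X) ≤ v + single (absorb X)) := by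
  rcases absorb_spec X with ⟨h0, h1⟩ | ⟨hX, hg⟩
  · have ru := reg_dneg u
    have rv := reg_dneg v
    have rw' := reg_dneg w
    have rk := reg_dneg k
    refine ⟨?_, fun h => ?_, fun _ h => ?_⟩
    · rw [add_absorb h0 h1 (u + v + w), add_absorb h0 h1 (u + (v + w))]
      simp only [dneg_add]
      rw [assoc_reg ru rv rw']
    · have h := map_mono (BLHom.dneg C) h
      simp only [map_add] at h
      have h := cancel_reg ru rv rk h
      rw [add_absorb h0 h1 (u + w), add_absorb h0 h1 (v + w), dneg_add, dneg_add]
      exact add_le_add_right' (add_le_add_right' h _) _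
    · have h := map_mono (BLHom.dneg C) h
      simp only [map_add] at h
      have h := cancel_reg ru rv rw' (cancel_reg (reg_add' ru rw') (reg_add' rv rw') rk h)
      rw [add_absorb h0 h1 u, add_absorb h0 h1 v]
      exact add_le_add_right' h _
  · have dense : ∀ {u : GoodSeq C}, Covers X u → IsDense u := by
      intro u hu i
      rcases hu i with h | h
      · exact Or.inl h
      · exact hX _ h
    have div : ∀ {u : GoodSeq C}, Covers X u →
        ∀ i, (u i)ᶜ = 0 → ∃ σ : C, σᶜ = 0 ∧ u i * σ = absorb X := by
      intro u hu i h
      rcases hu i with h' | h'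
      · exact absurd h' (dense_ne_zero h)
      · exact hg _ h' h
    have du := dense hu
    have dv := dense hv
    have dw := dense hw
    have dk := dense hk
    refine ⟨?_, fun h => ?_, fun hwk h => ?_⟩
    · rw [assoc_dense du dv dw]
    · apply cancel_dense (dense_add' du dw) (dense_add' dv dw) dk (div hk)
      have := add_le_add_right' h w
      rwa [assoc_dense du dk dw, assoc_dense dv dk dw, GoodSeq.add_comm k w,
        ← assoc_dense du dw dk, ← assoc_dense dv dw dk] at this
    · rw [assoc_dense du dw dk, assoc_dense dv dw dk] at h
      exact cancel_dense du dv (dense hwk) (div hwk) h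

end Absorb

section Absorb2

variable {L : Type u} [BLAlgebra L]

theorem exists_absorb (us : List (GoodSeq L)) : ∃ g : GoodSeq L,
    ∀ u ∈ us, ∀ v ∈ us, ∀ w ∈ us, ∀ k ∈ us,
      u + v + w + g = u + (v + w) + g ∧
      (u + k ≤ v + k → u + w + g ≤ v + w + g) ∧
      (w + k ∈ us → u + w + k ≤ v + w + k → u + g ≤ v + g) := by
  obtain ⟨X, hX⟩ := exists_covers us
  refine ⟨single (absorb X), fun u hu v hv w hw k hk => ⟨?_, fun h => ?_, fun hwk h => ?_⟩⟩
  · refine eq_of_chain fun C _ _ f => ?_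
    simp only [map_add, map_single, map_absorb]
    exact (absorb_chain ((hX u hu).map f) ((hX v hv).map f) ((hX w hw).map f)
      ((hX k hk).map f)).1
  · refine le_of_chain fun C _ _ f => ?_
    have h := map_mono f h
    simp only [map_add, map_single, map_absorb] at h ⊢
    exact (absorb_chain ((hX u hu).map f) ((hX v hv).map f) ((hX w hw).map f)
      ((hX k hk).map f)).2.1 h
  · refine le_of_chain fun C _ _ f => ?_
    have h := map_mono f h
    simp only [map_add, map_single, map_absorb] at h ⊢
    refine (absorb_chain ((hX u hu).map f) ((hX v hv).map f) ((hX w hw).map f)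
      ((hX k hk).map f)).2.2 ?_ h
    rw [← map_add]
    exact (hX _ hwk).map f

theorem sup_add' (u v w : GoodSeq L) : (u ⊔ v) + w = (u + w) ⊔ (v + w) := by
  refine eq_of_chain fun C _ _ f => ?_
  simp only [map_add, map_sup]
  rcases GoodSeq.total (map f u) (map f v) with h | h
  · rw [sup_eq_right.2 h, sup_eq_right.2 (add_le_add_right' h _)]
  · rw [sup_eq_left.2 h, sup_eq_left.2 (add_le_add_right' h _)]

theorem inf_add' (u v w : GoodSeq L) : (u ⊓ v) + w = (u + w) ⊓ (v + w) := by
  refine eq_of_chain fun C _ _ f => ?_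
  simp only [map_add, map_inf]
  rcases GoodSeq.total (map f u) (map f v) with h | h
  · rw [inf_eq_left.2 h, inf_eq_left.2 (add_le_add_right' h _)]
  · rw [inf_eq_right.2 h, inf_eq_right.2 (add_le_add_right' h _)]

/-- The preorder `u + k ≤ v + k` for some `k`. -/
def Le (u v : GoodSeq L) : Prop := ∃ k, u + k ≤ v + k

theorem Le.of_le {u v : GoodSeq L} (h : u ≤ v) : Le u v := ⟨0, add_le_add_right' h _⟩

/-- Two relations `Le` have a common witness. -/
theorem Le.common {u v u' v' : GoodSeq L} (h : Le u v) (h' : Le u' v') :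
    ∃ k, u + k ≤ v + k ∧ u' + k ≤ v' + k := by
  obtain ⟨k, h⟩ := h
  obtain ⟨l, h'⟩ := h'
  obtain ⟨g, hg⟩ := exists_absorb [u, v, u', v', k, l, 0]
  refine ⟨g, ?_, ?_⟩
  · have := (hg u (by simp) v (by simp) 0 (by simp) k (by simp)).2.1 h
    rwa [GoodSeq.add_zero, GoodSeq.add_zero] at this
  · have := (hg u' (by simp) v' (by simp) 0 (by simp) l (by simp)).2.1 h'
    rwa [GoodSeq.add_zero, GoodSeq.add_zero] at this

theorem Le.trans {u v w : GoodSeq L} (h : Le u v) (h' : Le v w) : Le u w := by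
  obtain ⟨k, h1, h2⟩ := h.common h'
  exact ⟨k, h1.trans h2⟩

theorem Le.add_right {u v : GoodSeq L} (h : Le u v) (w : GoodSeq L) : Le (u + w) (v + w) := by
  obtain ⟨k, h⟩ := h
  obtain ⟨g, hg⟩ := exists_absorb [u, v, w, k]
  exact ⟨g, (hg u (by simp) v (by simp) w (by simp) k (by simp)).2.1 h⟩

theorem Le.cancel {u v w : GoodSeq L} (h : Le (u + w) (v + w)) : Le u v := by
  obtain ⟨k, h⟩ := h
  obtain ⟨g, hg⟩ := exists_absorb [u, v, w, k, w + k]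
  exact ⟨g, (hg u (by simp) v (by simp) w (by simp) k (by simp)).2.2 (by simp) h⟩

theorem Le.sup {u v w : GoodSeq L} (h : Le u w) (h' : Le v w) : Le (u ⊔ v) w := by
  obtain ⟨k, h1, h2⟩ := h.common h'
  exact ⟨k, by rw [sup_add']; exact sup_le h1 h2⟩

theorem Le.inf {u v w : GoodSeq L} (h : Le w u) (h' : Le w v) : Le w (u ⊓ v) := by
  obtain ⟨k, h1, h2⟩ := h.common h'
  exact ⟨k, by rw [inf_add']; exact le_inf h1 h2⟩

theorem eqv_iff {u v : GoodSeq L} : (∃ k, u + k = v + k) ↔ Le u v ∧ Le v u := by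
  constructor
  · rintro ⟨k, h⟩
    exact ⟨⟨k, h.le⟩, ⟨k, h.ge⟩⟩
  · rintro ⟨h, h'⟩
    obtain ⟨k, h1, h2⟩ := h.common h'
    exact ⟨k, le_antisymm h1 h2⟩

theorem assoc_eqv (u v w : GoodSeq L) : ∃ k, u + v + w + k = u + (v + w) + k := by
  obtain ⟨g, hg⟩ := exists_absorb [u, v, w]
  exact ⟨g, (hg u (by simp) v (by simp) w (by simp) w (by simp)).1⟩

/-- The largest cancellative quotient of the good sequences: `u` and `v` are identified when
`u + k = v + k` for some `k`. -/
def cancelSetoid (L : Type u) [BLAlgebra L] : Setoid (GoodSeq L) where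
  r u v := ∃ k, u + k = v + k
  iseqv := by
    refine ⟨fun u => ⟨0, rfl⟩, fun ⟨k, h⟩ => ⟨k, h.symm⟩, fun h h' => ?_⟩
    rw [eqv_iff] at *
    exact ⟨h.1.trans h'.1, h'.2.trans h.2⟩

/-- The quotient by `cancelSetoid`. -/
def CancelQuot (L : Type u) [BLAlgebra L] : Type u := Quotient (cancelSetoid L)

/-- The class of a good sequence. -/
def cls (u : GoodSeq L) : CancelQuot L := Quotient.mk (cancelSetoid L) u

theorem cls_eq {u v : GoodSeq L} : cls u = cls v ↔ ∃ k, u + k = v + k :=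
  Quotient.eq (r := cancelSetoid L)

theorem Le.congr_add {u v u' v' : GoodSeq L} (h : ∃ k, u + k = v + k)
    (h' : ∃ k, u' + k = v' + k) : ∃ k, u + u' + k = v + v' + k := by
  have aux : ∀ {u v u' v' : GoodSeq L}, Le u v → Le u' v' → Le (u + u') (v + v') := by
    intro u v u' v' h h'
    have h2 := h'.add_right v
    rw [GoodSeq.add_comm u', GoodSeq.add_comm v'] at h2
    exact (h.add_right u').trans h2
  rw [eqv_iff] at *
  exact ⟨aux h.1 h'.1, aux h.2 h'.2⟩

instance : Zero (CancelQuot L) := ⟨cls 0⟩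

instance : Add (CancelQuot L) where
  add := Quotient.map₂ (sa := cancelSetoid L) (sb := cancelSetoid L) (sc := cancelSetoid L)
    (· + ·) fun _ _ h _ _ h' => Le.congr_add h h'

instance : AddCancelCommMonoid (CancelQuot L) where
  add_assoc := by
    rintro ⟨u⟩ ⟨v⟩ ⟨w⟩
    exact cls_eq.2 (assoc_eqv u v w)
  zero_add := by
    rintro ⟨u⟩
    exact congrArg cls (GoodSeq.zero_add u)
  add_zero := by
    rintro ⟨u⟩
    exact congrArg cls (GoodSeq.add_zero u)
  add_comm := by
    rintro ⟨u⟩ ⟨v⟩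
    exact congrArg cls (GoodSeq.add_comm u v)
  nsmul := nsmulRec
  add_left_cancel := by
    rintro ⟨u⟩ ⟨v⟩ ⟨w⟩ h
    have h2 : ∃ k, u + v + k = u + w + k := cls_eq.1 h
    apply cls_eq.2
    rw [GoodSeq.add_comm u v, GoodSeq.add_comm u w, eqv_iff] at h2
    exact eqv_iff.2 ⟨h2.1.cancel, h2.2.cancel⟩

theorem cls_add (u v : GoodSeq L) : cls (u + v) = cls u + cls v := rfl

instance : PartialOrder (CancelQuot L) where
  le := Quotient.lift₂ (s₁ := cancelSetoid L) (s₂ := cancelSetoid L) Le (by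
    intro u v u' v' h h'
    have h := eqv_iff.1 h
    have h' := eqv_iff.1 h'
    exact propext ⟨fun e => (h.2.trans e).trans h'.1, fun e => (h.1.trans e).trans h'.2⟩)
  le_refl := by
    rintro ⟨u⟩
    exact Le.of_le le_rfl
  le_trans := by
    rintro ⟨u⟩ ⟨v⟩ ⟨w⟩ h h'
    exact Le.trans h h'
  le_antisymm := by
    rintro ⟨u⟩ ⟨v⟩ h h'
    exact cls_eq.2 (eqv_iff.2 ⟨h, h'⟩)

theorem cls_le {u v : GoodSeq L} : cls u ≤ cls v ↔ ∃ k, u + k ≤ v + k := Iff.rfl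

instance : IsOrderedCancelAddMonoid (CancelQuot L) where
  add_le_add_left := by
    rintro ⟨u⟩ ⟨v⟩ h ⟨w⟩
    exact Le.add_right h w
  le_of_add_le_add_left := by
    rintro ⟨u⟩ ⟨v⟩ ⟨w⟩ h
    have h2 : Le (u + v) (u + w) := h
    rw [GoodSeq.add_comm u v, GoodSeq.add_comm u w] at h2
    exact h2.cancel

end Absorb2

end GoodSeq

section ChangGroup

open GoodSeq

variable {L : Type u} [BLAlgebra L]

/-- Pairs of good sequences `(a, b)` and `(c, d)` are identified when `a + d + k = b + c + k` for
some good sequence `k`. -/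
def changSetoid (L : Type u) [BLAlgebra L] : Setoid (GoodSeq L × GoodSeq L) where
  r p q := ∃ k : GoodSeq L, p.1 + q.2 + k = p.2 + q.1 + k
  iseqv := by
    simp only [← cls_eq, cls_add]
    refine ⟨fun p => add_comm _ _, fun {p q} h => ?_, fun {p q r} h h' => ?_⟩
    · rw [add_comm, ← h, add_comm]
    · apply add_right_cancel (b := cls q.1 + cls q.2)
      calc cls p.1 + cls r.2 + (cls q.1 + cls q.2)
          = (cls p.1 + cls q.2) + (cls q.1 + cls r.2) := by abel
        _ = cls p.2 + cls r.1 + (cls q.1 + cls q.2) := by rw [h, h']; abel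

/-- The Chang group `G_L` of a BL-algebra `L`. -/
def ChangGroup (L : Type u) [BLAlgebra L] : Type u := Quotient (changSetoid L)

namespace ChangGroup

/-- The class `[a, b]` of a pair of good sequences. -/
def mk (a b : GoodSeq L) : ChangGroup L := Quotient.mk (changSetoid L) (a, b)

theorem mk_eq {a b c d : GoodSeq L} : mk a b = mk c d ↔ ∃ k, a + d + k = b + c + k :=
  Quotient.eq (r := changSetoid L)

theorem mk_eq' {a b c d : GoodSeq L} : mk a b = mk c d ↔ cls a + cls d = cls b + cls c := by
  rw [mk_eq, ← cls_eq, cls_add, cls_add]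

/-- `0 = [(0), (0)]`. -/
instance : Zero (ChangGroup L) := ⟨mk 0 0⟩

/-- `[a, b] + [c, d] = [a + c, b + d]`. -/
instance : Add (ChangGroup L) where
  add := Quotient.lift₂ (s₁ := changSetoid L) (s₂ := changSetoid L)
    (fun p q => mk (p.1 + q.1) (p.2 + q.2)) (by
      rintro ⟨a, b⟩ ⟨c, d⟩ ⟨a', b'⟩ ⟨c', d'⟩ h h'
      have h : cls a + cls b' = cls b + cls a' := mk_eq'.1 (mk_eq.2 h)
      have h' : cls c + cls d' = cls d + cls c' := mk_eq'.1 (mk_eq.2 h')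
      rw [mk_eq']
      simp only [cls_add]
      rw [add_add_add_comm, h, h', add_add_add_comm])

/-- `-[a, b] = [b, a]`. -/
instance : Neg (ChangGroup L) where
  neg := Quotient.lift (s := changSetoid L) (fun p => mk p.2 p.1) (by
    rintro ⟨a, b⟩ ⟨a', b'⟩ h
    have h : cls a + cls b' = cls b + cls a' := mk_eq'.1 (mk_eq.2 h)
    rw [mk_eq']
    exact h.symm)

instance : AddCommGroup (ChangGroup L) where
  add_assoc := by
    rintro ⟨a, b⟩ ⟨c, d⟩ ⟨e, f⟩
    change mk (a + c + e) (b + d + f) = mk (a + (c + e)) (b + (d + f))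
    rw [mk_eq']
    simp only [cls_add]
    abel
  zero_add := by
    rintro ⟨a, b⟩
    change mk (0 + a) (0 + b) = mk a b
    rw [GoodSeq.zero_add, GoodSeq.zero_add]
  add_zero := by
    rintro ⟨a, b⟩
    change mk (a + 0) (b + 0) = mk a b
    rw [GoodSeq.add_zero, GoodSeq.add_zero]
  add_comm := by
    rintro ⟨a, b⟩ ⟨c, d⟩
    change mk (a + c) (b + d) = mk (c + a) (d + b)
    rw [GoodSeq.add_comm, GoodSeq.add_comm b]
  neg_add_cancel := by
    rintro ⟨a, b⟩
    change mk (b + a) (a + b) = mk 0 0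
    rw [mk_eq']
    simp only [cls_add]
    abel
  nsmul := nsmulRec
  zsmul := zsmulRec

theorem mk_add_mk (a b c d : GoodSeq L) : mk a b + mk c d = mk (a + c) (b + d) := rfl

theorem zero_def : (0 : ChangGroup L) = mk 0 0 := rfl

theorem neg_mk (a b : GoodSeq L) : -mk a b = mk b a := rfl

/-- The order: `[a, b] ≤ [c, d]` iff `a + d + k ≤ b + c + k` for some good sequence `k`. -/
instance : PartialOrder (ChangGroup L) where
  le := Quotient.lift₂ (s₁ := changSetoid L) (s₂ := changSetoid L)
    (fun p q => ∃ k : GoodSeq L, p.1 + q.2 + k ≤ p.2 + q.1 + k) (by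
      rintro ⟨a, b⟩ ⟨c, d⟩ ⟨a', b'⟩ ⟨c', d'⟩ h h'
      have h : cls a + cls b' = cls b + cls a' := mk_eq'.1 (mk_eq.2 h)
      have h' : cls c + cls d' = cls d + cls c' := mk_eq'.1 (mk_eq.2 h')
      simp only [← cls_le, cls_add, eq_iff_iff]
      rw [← add_le_add_iff_right (cls b' + cls c')]
      have e1 : cls a + cls d + (cls b' + cls c') = cls a' + cls d' + (cls b + cls c) := by
        calc _ = (cls a + cls b') + (cls d + cls c') := by abel
          _ = _ := by rw [h, ← h']; abel
      have e2 : cls b + cls c + (cls b' + cls c') = cls b' + cls c' + (cls b + cls c) := by abel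
      rw [e1, e2, add_le_add_iff_right])
  le_refl := by
    rintro ⟨a, b⟩
    exact ⟨0, by rw [GoodSeq.add_comm a b]⟩
  le_trans := by
    rintro ⟨a, b⟩ ⟨c, d⟩ ⟨e, f⟩ h h'
    have h : cls a + cls d ≤ cls b + cls c := h
    have h' : cls c + cls f ≤ cls d + cls e := h'
    change cls a + cls f ≤ cls b + cls e
    rw [← add_le_add_iff_right (cls c + cls d)]
    calc _ = (cls a + cls d) + (cls c + cls f) := by abel
      _ ≤ _ := add_le_add h h'
      _ = _ := by abel
  le_antisymm := by
    rintro ⟨a, b⟩ ⟨c, d⟩ h h'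
    have h : cls a + cls d ≤ cls b + cls c := h
    have h' : cls c + cls b ≤ cls d + cls a := h'
    refine mk_eq'.2 (le_antisymm h ?_)
    rwa [add_comm (cls b), add_comm (cls a)]

theorem mk_le_mk {a b c d : GoodSeq L} : mk a b ≤ mk c d ↔ ∃ k, a + d + k ≤ b + c + k :=
  Iff.rfl

theorem mk_le_mk' {a b c d : GoodSeq L} : mk a b ≤ mk c d ↔ cls a + cls d ≤ cls b + cls c :=
  Iff.rfl

instance : IsOrderedAddMonoid (ChangGroup L) where
  add_le_add_left := by
    rintro ⟨a, b⟩ ⟨c, d⟩ h ⟨e, f⟩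
    have h : cls a + cls d ≤ cls b + cls c := h
    change cls a + cls e + (cls d + cls f) ≤ cls b + cls f + (cls c + cls e)
    calc _ = (cls a + cls d) + (cls e + cls f) := by abel
      _ ≤ (cls b + cls c) + (cls e + cls f) := by gcongr
      _ = _ := by abel

theorem isLUB_mk (a b c d : GoodSeq L) :
    IsLUB {mk a b, mk c d} (mk ((a + d) ⊔ (b + c)) (b + d)) := by
  have l1 : cls (a + d) ≤ cls ((a + d) ⊔ (b + c)) := Le.of_le le_sup_left
  have l2 : cls (b + c) ≤ cls ((a + d) ⊔ (b + c)) := Le.of_le le_sup_right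
  rw [cls_add] at l1 l2
  constructor
  · rintro x (rfl | rfl)
    · rw [mk_le_mk', cls_add]
      calc _ = cls b + (cls a + cls d) := by abel
        _ ≤ _ := by gcongr
    · rw [mk_le_mk', cls_add]
      calc _ = cls d + (cls b + cls c) := by abel
        _ ≤ _ := by gcongr
  · rintro ⟨e, f⟩ h
    have h1 : cls a + cls f ≤ cls b + cls e := h (Set.mem_insert _ _)
    have h2 : cls c + cls f ≤ cls d + cls e := h (Set.mem_insert_of_mem _ rfl)
    change cls (((a + d) ⊔ (b + c)) + f) ≤ cls (b + d + e)
    rw [sup_add']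
    apply Le.sup
    · change cls a + cls d + cls f ≤ cls b + cls d + cls e
      calc _ = cls a + cls f + cls d := by abel
        _ ≤ cls b + cls e + cls d := by gcongr
        _ = _ := by abel
    · change cls b + cls c + cls f ≤ cls b + cls d + cls e
      calc _ = cls b + (cls c + cls f) := by abel
        _ ≤ cls b + (cls d + cls e) := by gcongr
        _ = _ := by abel

theorem isGLB_mk (a b c d : GoodSeq L) :
    IsGLB {mk a b, mk c d} (mk ((a + d) ⊓ (b + c)) (b + d)) := by
  have l1 : cls ((a + d) ⊓ (b + c)) ≤ cls (a + d) := Le.of_le inf_le_left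
  have l2 : cls ((a + d) ⊓ (b + c)) ≤ cls (b + c) := Le.of_le inf_le_right
  rw [cls_add] at l1 l2
  constructor
  · rintro x (rfl | rfl)
    · rw [mk_le_mk', cls_add]
      calc _ ≤ cls a + cls d + cls b := by gcongr
        _ = _ := by abel
    · rw [mk_le_mk', cls_add]
      calc _ ≤ cls b + cls c + cls d := by gcongr
        _ = _ := by abel
  · rintro ⟨e, f⟩ h
    have h1 : cls e + cls b ≤ cls f + cls a := h (Set.mem_insert _ _)
    have h2 : cls e + cls d ≤ cls f + cls c := h (Set.mem_insert_of_mem _ rfl)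
    change cls (e + (b + d)) ≤ cls (f + ((a + d) ⊓ (b + c)))
    rw [GoodSeq.add_comm f, inf_add']
    apply Le.inf
    · change cls e + (cls b + cls d) ≤ cls a + cls d + cls f
      calc _ = cls e + cls b + cls d := by abel
        _ ≤ cls f + cls a + cls d := by gcongr
        _ = _ := by abel
    · change cls e + (cls b + cls d) ≤ cls b + cls c + cls f
      calc _ = cls e + cls d + cls b := by abel
        _ ≤ cls f + cls c + cls b := by gcongr
        _ = _ := by abel

/-- The lattice operations: `[a, b] ⊔ [c, d] = [(a + d) ⊔ (b + c), b + d]` and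
`[a, b] ⊓ [c, d] = [(a + d) ⊓ (b + c), b + d]`. -/
instance : Lattice (ChangGroup L) where
  sup := Quotient.lift₂ (s₁ := changSetoid L) (s₂ := changSetoid L)
    (fun p q => mk ((p.1 + q.2) ⊔ (p.2 + q.1)) (p.2 + q.2)) (by
      rintro ⟨a, b⟩ ⟨c, d⟩ ⟨a', b'⟩ ⟨c', d'⟩ h h'
      have e : mk a b = mk a' b' := mk_eq.2 h
      have e' : mk c d = mk c' d' := mk_eq.2 h'
      have h := isLUB_mk a b c d
      rw [e, e'] at h
      exact h.unique (isLUB_mk a' b' c' d'))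
  inf := Quotient.lift₂ (s₁ := changSetoid L) (s₂ := changSetoid L)
    (fun p q => mk ((p.1 + q.2) ⊓ (p.2 + q.1)) (p.2 + q.2)) (by
      rintro ⟨a, b⟩ ⟨c, d⟩ ⟨a', b'⟩ ⟨c', d'⟩ h h'
      have e : mk a b = mk a' b' := mk_eq.2 h
      have e' : mk c d = mk c' d' := mk_eq.2 h'
      have h := isGLB_mk a b c d
      rw [e, e'] at h
      exact h.unique (isGLB_mk a' b' c' d'))
  le_sup_left := by
    rintro ⟨a, b⟩ ⟨c, d⟩
    exact (isLUB_mk a b c d).1 (Set.mem_insert _ _)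
  le_sup_right := by
    rintro ⟨a, b⟩ ⟨c, d⟩
    exact (isLUB_mk a b c d).1 (Set.mem_insert_of_mem _ rfl)
  sup_le := by
    rintro ⟨a, b⟩ ⟨c, d⟩ x h h'
    apply (isLUB_mk a b c d).2
    rintro y (rfl | rfl)
    · exact h
    · exact h'
  inf_le_left := by
    rintro ⟨a, b⟩ ⟨c, d⟩
    exact (isGLB_mk a b c d).1 (Set.mem_insert _ _)
  inf_le_right := by
    rintro ⟨a, b⟩ ⟨c, d⟩
    exact (isGLB_mk a b c d).1 (Set.mem_insert_of_mem _ rfl)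
  le_inf := by
    rintro x ⟨a, b⟩ ⟨c, d⟩ h h'
    apply (isGLB_mk a b c d).2
    rintro y (rfl | rfl)
    · exact h
    · exact h'

theorem mk_sup_mk (a b c d : GoodSeq L) :
    mk a b ⊔ mk c d = mk ((a + d) ⊔ (b + c)) (b + d) := rfl

theorem mk_inf_mk (a b c d : GoodSeq L) :
    mk a b ⊓ mk c d = mk ((a + d) ⊓ (b + c)) (b + d) := rfl

/-- The homomorphism `[a, b] ↦ [f a, f b]` of Chang groups induced by a homomorphism `f` of
BL-algebras. -/
def map {M : Type u} [BLAlgebra M] (f : BLHom L M) : ChangGroup L →+ ChangGroup M where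
  toFun := Quotient.lift (s := changSetoid L) (fun p => mk (GoodSeq.map f p.1) (GoodSeq.map f p.2))
    (by
      rintro ⟨a, b⟩ ⟨c, d⟩ ⟨k, h⟩
      refine mk_eq.2 ⟨GoodSeq.map f k, ?_⟩
      have h := congrArg (GoodSeq.map f) h
      simpa only [GoodSeq.map_add] using h)
  map_zero' := by
    change mk (GoodSeq.map f 0) (GoodSeq.map f 0) = mk 0 0
    rw [GoodSeq.map_zero]
  map_add' := by
    rintro ⟨a, b⟩ ⟨c, d⟩
    change mk (GoodSeq.map f (a + c)) (GoodSeq.map f (b + d)) = mk (_ + _) (_ + _)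
    rw [GoodSeq.map_add, GoodSeq.map_add]

theorem map_mk {M : Type u} [BLAlgebra M] (f : BLHom L M) (a b : GoodSeq L) :
    map f (mk a b) = mk (GoodSeq.map f a) (GoodSeq.map f b) := rfl

end ChangGroup

end ChangGroup

/-- The MV-center `{xᶜ : x ∈ L}` of a BL-algebra `L`. -/
def MVCenter (L : Type u) [BLAlgebra L] : Type u := {y : L // ∃ x : L, xᶜ = y}

namespace MVCenter

open BLAlgebra

variable {L : Type u} [BLAlgebra L]

/-- The operations of the MV-center are the restrictions of those of `L`. -/
instance : BLAlgebra (MVCenter L) where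
  mul x y := ⟨x.1 * y.1, by
    obtain ⟨⟨_, a, rfl⟩, ⟨_, b, rfl⟩⟩ := x, y
    exact ⟨(aᶜ * bᶜ)ᶜ, by rw [compl_compl_mul, compl3, compl3]⟩⟩
  himp x y := ⟨x.1 ⇨ y.1, by
    obtain ⟨⟨x, -⟩, ⟨_, b, rfl⟩⟩ := x, y
    exact ⟨x * b, (himp_compl x b).symm⟩⟩
  one := ⟨1, 0, compl_zero⟩
  zero := ⟨0, 1, compl_one⟩
  mul_assoc x y z := Subtype.ext (mul_assoc x.1 y.1 z.1)
  one_mul x := Subtype.ext (one_mul x.1)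
  mul_one x := Subtype.ext (mul_one x.1)
  mul_comm x y := Subtype.ext (mul_comm x.1 y.1)
  himp_refl x := Subtype.ext (himp_refl x.1)
  mul_himp_comm x y := Subtype.ext (mul_himp_comm x.1 y.1)
  himp_curry x y z := Subtype.ext (himp_curry x.1 y.1 z.1)
  zero_himp x := Subtype.ext (zero_himp x.1)
  prelinear x y z := Subtype.ext (prelinear x.1 y.1 z.1)

/-- The inclusion of the MV-center. -/
def incl (L : Type u) [BLAlgebra L] : BLHom (MVCenter L) L where
  toFun := Subtype.val
  map_mul' _ _ := rfl
  map_himp' _ _ := rfl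
  map_zero' := rfl

end MVCenter

/-- The set `𝔖(L)` of the classes `[a, b]` such that the termwise double negations of `a` and `b`
are equal. -/
def changComplement (L : Type u) [BLAlgebra L] : Set (ChangGroup L) :=
  {x | ∃ a b : GoodSeq L, x = ChangGroup.mk a b ∧ ∀ i, (a i)ᶜᶜ = (b i)ᶜᶜ}

/-- Ideals of an abelian lattice-ordered group: convex subgroups that are sublattices. -/
structure IsLIdeal {G : Type u} [AddCommGroup G] [Lattice G] (S : AddSubgroup G) : Prop where
  sup_mem : ∀ {x y : G}, x ∈ S → y ∈ S → x ⊔ y ∈ S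
  inf_mem : ∀ {x y : G}, x ∈ S → y ∈ S → x ⊓ y ∈ S
  convex : ∀ {x y z : G}, x ∈ S → z ∈ S → x ≤ y → y ≤ z → y ∈ S

/-- The homomorphism from the Chang group `G_A` of the MV-center `A` of `L` to the Chang group
`G_L`, `[a, b] ↦ [a, b]`. -/
def changIncl (L : Type u) [BLAlgebra L] : ChangGroup (MVCenter L) →+ ChangGroup L :=
  ChangGroup.map (MVCenter.incl L)

/-! ### Functoriality of the Chang group: order, lattice operations and kernels. -/

namespace ChangGroup

open BLAlgebra

variable {L M : Type u} [BLAlgebra L] [BLAlgebra M] (f : BLHom L M)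

/-! The MV-center `A` is a retract of `L`. Double negation is a homomorphism of BL-algebras from `L`
onto `A` (`MVCenter.retract`), and it fixes every element of `A` because triple negation equals
single negation. The Chang group is functorial, so the inclusion `i : G_A → G_L` and the map `r :
G_L → G_A` induced by double negation satisfy `r ∘ i = id` (`map_retract_changIncl`).

Most of the theorem follows from this identity. The map `i` is injective, and `G_L` is the direct
sum of the range of `i` and the kernel of `r`. Induced maps are monotone and commute with joins and
meets, since both the order and the operations are given on representatives by `+` and the termwise
lattice operations. Thus `i` preserves the order, and it reflects the order because `r` is monotone
too. The kernel of `r` is a convex sublattice, as is the kernel of every such map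
(`ChangGroup.isLIdeal_ker`).

It remains to see that the kernel of `r` is `𝔖(L)` (`ker_map_retract`). A class `[a, b]` lies in the
kernel when the double negations of `a` and `b` become equal after adding some good sequence `k` of
`A`. Over `A` this `k` can be cancelled (`MVCenter.add_right_cancel_goodSeq`), which leaves termwise
equality, the condition defining `𝔖(L)`. Cancellation needs the regularity of the elements of `A`.
Over `L` it can fail: in a chain with an element `g` that is neither zero nor dense, adding `single
g` to a sequence or to its double negation gives the same result (`GoodSeq.add_absorb`). -/

theorem map_mono {x y : ChangGroup L} (h : x ≤ y) : map f x ≤ map f y := by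
  obtain ⟨⟨a, b⟩, rfl⟩ := Quotient.exists_rep x
  obtain ⟨⟨c, d⟩, rfl⟩ := Quotient.exists_rep y
  obtain ⟨k, h⟩ := mk_le_mk.1 h
  -- The order on classes is existential in `k`, and the image of a witness is again a witness.
  refine mk_le_mk.2 ⟨GoodSeq.map f k, ?_⟩
  simpa only [GoodSeq.map_add] using GoodSeq.map_mono f h

theorem map_sup (x y : ChangGroup L) : map f (x ⊔ y) = map f x ⊔ map f y := by
  obtain ⟨⟨a, b⟩, rfl⟩ := Quotient.exists_rep x
  obtain ⟨⟨c, d⟩, rfl⟩ := Quotient.exists_rep y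
  -- On representatives the join involves only `+` and the termwise join of good sequences, and `f`
  -- commutes with both.
  change map f (mk ((a + d) ⊔ (b + c)) (b + d)) = map f (mk a b) ⊔ map f (mk c d)
  simp only [map_mk, mk_sup_mk, GoodSeq.map_sup, GoodSeq.map_add]

theorem map_inf (x y : ChangGroup L) : map f (x ⊓ y) = map f x ⊓ map f y := by
  obtain ⟨⟨a, b⟩, rfl⟩ := Quotient.exists_rep x
  obtain ⟨⟨c, d⟩, rfl⟩ := Quotient.exists_rep y
  change map f (mk ((a + d) ⊓ (b + c)) (b + d)) = map f (mk a b) ⊓ map f (mk c d)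
  simp only [map_mk, mk_inf_mk, GoodSeq.map_inf, GoodSeq.map_add]

/-- Only the compatibility of the induced map with joins, meets and order matters. Applied to the
kernel of the retraction, this yields the ideal property of `𝔖(L)` without computing with good
sequences. -/
theorem isLIdeal_ker : IsLIdeal (map f).ker where
  sup_mem {x y} hx hy := by
    rw [AddMonoidHom.mem_ker] at *
    rw [map_sup, hx, hy, sup_idem]
  inf_mem {x y} hx hy := by
    rw [AddMonoidHom.mem_ker] at *
    rw [map_inf, hx, hy, inf_idem]
  convex {x y z} hx hz hxy hyz := by
    rw [AddMonoidHom.mem_ker] at *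
    -- The image of `y` is squeezed between the images of `x` and `z`, both zero.
    exact le_antisymm (hz ▸ map_mono f hyz) (hx ▸ map_mono f hxy)

end ChangGroup

/-! ### The retraction onto the MV-center and cancellation over it. -/

namespace MVCenter

open BLAlgebra

variable {L : Type u} [BLAlgebra L]

/-- Every element of the center is a complement, and triple negation is single negation. This
regularity is used twice: it makes double negation a retraction, and it permits cancellation of good
sequences. -/
theorem compl_compl_eq (x : MVCenter L) : xᶜᶜ = x := by
  obtain ⟨_, a, rfl⟩ := x
  exact Subtype.ext (compl3 a)

/-- Double negation, as a homomorphism onto the MV-center. -/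
def retract (L : Type u) [BLAlgebra L] : BLHom L (MVCenter L) where
  toFun x := ⟨xᶜᶜ, xᶜ, rfl⟩
  -- Compatibility of double negation with `*` and `⇨` is checked in chains, where every element is
  -- dense or regular.
  map_mul' x y := Subtype.ext (compl_compl_mul x y)
  map_himp' x y := Subtype.ext (compl_compl_himp x y)
  map_zero' := Subtype.ext (BLHom.dneg L).map_zero

theorem retract_incl (x : MVCenter L) : retract L (incl L x) = x := compl_compl_eq x

/-- An equality of good sequences can be tested in chains. There a regular sequence `k` has a
complement whose sum with `k` is `(1, …, 1, 0, …)`. Adding that sum merely puts ones in front of a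
sequence, which is reversible, and sums of regular sequences associate; hence `GoodSeq.cancel_reg`.
This is the step that removes the auxiliary sequence from the definition of the Chang group. -/
theorem add_right_cancel_goodSeq {u v k : GoodSeq (MVCenter L)} (h : u + k = v + k) : u = v := by
  refine GoodSeq.eq_of_chain fun C _ _ f => ?_
  -- The chain `C` may contain elements that are not regular. It suffices that regularity is an
  -- equation, so that it holds for the images of elements of the center.
  have reg : ∀ w : GoodSeq (MVCenter L), GoodSeq.IsReg (GoodSeq.map f w) := fun w i => by
    change (f (w i))ᶜᶜ = f (w i)
    rw [← f.map_compl, ← f.map_compl, compl_compl_eq]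
  have h' := congrArg (GoodSeq.map f) h
  rw [GoodSeq.map_add, GoodSeq.map_add] at h'
  -- Cancellation in a chain is available for inequalities, so it is applied in both directions.
  exact le_antisymm (GoodSeq.cancel_reg (reg u) (reg v) (reg k) h'.le)
    (GoodSeq.cancel_reg (reg v) (reg u) (reg k) h'.ge)

end MVCenter

/-! ### The splitting of the Chang group. -/

/-- The identity holds already on representatives, term by term, because double negation fixes the
center. Injectivity, reflection of the order and the direct sum decomposition are all drawn from it.
-/
theorem map_retract_changIncl {L : Type u} [BLAlgebra L] (x : ChangGroup (MVCenter L)) :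
    ChangGroup.map (MVCenter.retract L) (changIncl L x) = x := by
  obtain ⟨⟨a, b⟩, rfl⟩ := Quotient.exists_rep x
  have e : ∀ u : GoodSeq (MVCenter L),
      GoodSeq.map (MVCenter.retract L) (GoodSeq.map (MVCenter.incl L) u) = u :=
    fun u => GoodSeq.ext' fun i => MVCenter.retract_incl (u i)
  exact congrArg₂ ChangGroup.mk (e a) (e b)

/-- That `𝔖(L)` is a subgroup comes for free once it is recognised as a kernel. The inclusion of the
kernel in `𝔖(L)` rests on cancellation over the center; the other inclusion is immediate. -/
theorem ker_map_retract (L : Type u) [BLAlgebra L] :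
    ((ChangGroup.map (MVCenter.retract L)).ker : Set (ChangGroup L)) = changComplement L := by
  ext x
  rw [SetLike.mem_coe, AddMonoidHom.mem_ker]
  constructor
  · intro h
    obtain ⟨⟨a, b⟩, rfl⟩ := Quotient.exists_rep x
    -- Any representative will do: although `𝔖(L)` asks for one suitable pair, cancellation shows
    -- that every pair representing an element of the kernel has equal double negations.
    refine ⟨a, b, rfl, fun i => ?_⟩
    obtain ⟨k, hk⟩ := ChangGroup.mk_eq.1 h
    -- The two zeros are the components of `0 = mk 0 0`.
    rw [GoodSeq.add_zero, GoodSeq.add_zero] at hk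
    have e := MVCenter.add_right_cancel_goodSeq hk
    exact congrArg (fun u : GoodSeq (MVCenter L) => (u i).1) e
  · rintro ⟨a, b, rfl, h⟩
    have e : GoodSeq.map (MVCenter.retract L) a = GoodSeq.map (MVCenter.retract L) b :=
      GoodSeq.ext' fun i => Subtype.ext (h i)
    rw [ChangGroup.map_mk, e]
    -- A class with equal components is zero: both sides of the defining equation then coincide,
    -- whatever sequence is added.
    exact ChangGroup.mk_eq.2 ⟨0, rfl⟩

theorem theorem5p4 (L : Type u) [BLAlgebra L] :
    (Function.Injective (changIncl L) ∧
      (∀ x y : ChangGroup (MVCenter L), changIncl L x ≤ changIncl L y ↔ x ≤ y) ∧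
      (∀ x y : ChangGroup (MVCenter L), changIncl L (x ⊔ y) = changIncl L x ⊔ changIncl L y) ∧
      (∀ x y : ChangGroup (MVCenter L), changIncl L (x ⊓ y) = changIncl L x ⊓ changIncl L y)) ∧
    ∃ S : AddSubgroup (ChangGroup L), (S : Set (ChangGroup L)) = changComplement L ∧
      IsCompl (changIncl L).range S ∧ IsLIdeal S := by
  -- The subgroup `S` is left to unification: `ker_map_retract` forces it to be the kernel of the
  -- retraction.
  refine ⟨⟨Function.LeftInverse.injective map_retract_changIncl,
    fun x y => ⟨fun h => ?_, ChangGroup.map_mono _⟩, ChangGroup.map_sup _, ChangGroup.map_inf _⟩,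
    _, ker_map_retract L, ⟨?_, ?_⟩, ChangGroup.isLIdeal_ker _⟩
  -- Reflection of the order: the retraction is monotone and undoes the inclusion.
  · have := ChangGroup.map_mono (MVCenter.retract L) h
    rwa [map_retract_changIncl, map_retract_changIncl] at this
  · rw [AddSubgroup.disjoint_def]
    rintro _ ⟨y, rfl⟩ h
    rw [AddMonoidHom.mem_ker, map_retract_changIncl] at h
    rw [h, map_zero]
  · rw [codisjoint_iff, eq_top_iff]
    intro x _
    -- The usual splitting `x = i (r x) + (x - i (r x))`. For `x = [a, b]`, with `a'` and `b'` the
    -- termwise double negations, the second summand is `[a + b', b + a']`, whose components both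
    -- have double negation `a' + b'`.
    refine AddSubgroup.mem_sup.2
      ⟨changIncl L (ChangGroup.map (MVCenter.retract L) x), ⟨_, rfl⟩,
        x - changIncl L (ChangGroup.map (MVCenter.retract L) x), ?_, add_sub_cancel _ _⟩
    rw [AddMonoidHom.mem_ker, map_sub, map_retract_changIncl, sub_self]
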